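/- For $f:[0,\pi/2]\to\mathbb R$ write $\langle f\rangle=\frac2\pi\int_0^{\pi/2}f(\theta)\,d\theta$ and $D_\theta f=\sin(2\theta)\,\partial_\theta f$. For a pair $V=(V_1,V_2)$ of functions on $[0,\pi/2]$ put $$L_\theta V=\Big(2D_\theta V_1+6V_1-V_2,\ \ 2D_\theta V_2+9V_2-130\cos^2\theta\,\big(V_1-\langle V_1\rangle\big)\Big).$$ Let the profile $\Gamma^*=(\Gamma_1^*,\Gamma_2^*)$ be the solution, continuous on $[0,\pi/2]$ and differentiable on $(0,\pi/2)$, of $L_\theta\Gamma^*=0$ with $\langle \Gamma_1^*\rangle=2$. Put $$F^*=\Big(D_\theta\Gamma_1^*+\tfrac52\Gamma_1^*,\ D_\theta\Gamma_2^*+4\Gamma_2^*\Big),\qquad \mathcal L V=L_\theta V+\frac{\Gamma^*}{2}\langle V_1\rangle ,$$ where $D_\theta\Gamma_i^*$ is taken to be $0$ at $\theta=0$ and $\theta=\pi/2$. For $A\in\{L_\theta,\mathcal L\}$, $U(t)=\exp(-tA)F^*$ denotes the classical solution of $\partial_tU+AU=0$, $U(0)=F^*$ (continuous on $[0,\infty)\times[0,\pi/2]$,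 differentiable and satisfying the equation for $t>0$, $0<\theta<\pi/2$). Let $$\Upsilon(t)=\Big\langle\big(\exp(-t\mathcal L)F^*\big)_1\Big\rangle .$$ Equivalently, with $\Theta(t)=\exp(-tL_\theta)F^*$, $\Upsilon$ is the inverse Laplace transform of $\frac{\xi}{1+\xi}$ times the Laplace transform of $\langle \Theta_1\rangle$, that is, $$\Upsilon(t)=\langle \Theta_1(t)\rangle-\int_0^t e^{-(t-s)}\langle \Theta_1(s)\rangle\,ds .$$ Then (for $\Upsilon$ given by either expression) $\Upsilon(t)>0$ for all $t\ge\log 4$. -/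

import Mathlib

noncomputable section

namespace Angular

/-- Angular average: `(2/π) ∫_0^{π/2} f(θ) dθ`. -/
def avg (f : ℝ → ℝ) : ℝ := 2 / Real.pi * ∫ θ in (0 : ℝ)..(Real.pi / 2), f θ

/-- The derivation `D_θ f = sin(2θ) ∂_θ f`. At `θ = 0` and `θ = π/2` the factor `sin(2θ)`
vanishes, so the value there is `0`. -/
def D (f : ℝ → ℝ) (θ : ℝ) : ℝ := Real.sin (2 * θ) * deriv f θ

/-- The angular operator `L_θ`, acting on pairs of functions of `θ`:
`L_θ V = (2 D_θ V₁ + 6 V₁ - V₂, 2 D_θ V₂ + 9 V₂ - 130 cos²θ (V₁ - avg V₁))`. -/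
def Ltheta (V : ℝ → ℝ × ℝ) (θ : ℝ) : ℝ × ℝ :=
  (2 * D (fun s => (V s).1) θ + 6 * (V θ).1 - (V θ).2,
   2 * D (fun s => (V s).2) θ + 9 * (V θ).2
     - 130 * Real.cos θ ^ 2 * ((V θ).1 - avg (fun s => (V s).1)))

/-- The operator `𝓛 V = L_θ V + (Γ / 2) avg V₁` attached to the profile `Γ`. -/
def Lfull (Γ : ℝ → ℝ × ℝ) (V : ℝ → ℝ × ℝ) (θ : ℝ) : ℝ × ℝ :=
  Ltheta V θ + (avg (fun s => (V s).1) / 2) • Γ θ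

/-- `Γ` is the angular profile: it is continuous on `[0, π/2]`, differentiable inside,
and solves `L_θ Γ = 0` with `avg Γ₁ = 2`. (These conditions determine `Γ` on `[0, π/2]`.) -/
structure IsProfile (Γ : ℝ → ℝ × ℝ) : Prop where
  continuousOn : ContinuousOn Γ (Set.Icc 0 (Real.pi / 2))
  differentiableAt : ∀ θ ∈ Set.Ioo 0 (Real.pi / 2), DifferentiableAt ℝ Γ θ
  eqn : ∀ θ ∈ Set.Ioo 0 (Real.pi / 2), Ltheta Γ θ = 0
  avg_eq : avg (fun θ => (Γ θ).1) = 2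

/-- `F^* = (D_θ Γ₁ + (5/2) Γ₁, D_θ Γ₂ + 4 Γ₂)`. -/
def Fstar (Γ : ℝ → ℝ × ℝ) (θ : ℝ) : ℝ × ℝ :=
  (D (fun s => (Γ s).1) θ + 5 / 2 * (Γ θ).1, D (fun s => (Γ s).2) θ + 4 * (Γ θ).2)

/-- `U(t, θ) = (exp(-t A) V₀)(θ)`: `U` is a classical solution of `∂_t U + A U = 0` for `t > 0`,
`0 < θ < π/2`, continuous on `[0, ∞) × [0, π/2]`, with `U(0, ·) = V₀` on `[0, π/2]`. -/
structure IsEvolution (A : (ℝ → ℝ × ℝ) → ℝ → ℝ × ℝ) (V₀ : ℝ → ℝ × ℝ)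
    (U : ℝ → ℝ → ℝ × ℝ) : Prop where
  continuousOn : ContinuousOn (fun p : ℝ × ℝ => U p.1 p.2)
    (Set.Ici 0 ×ˢ Set.Icc 0 (Real.pi / 2))
  differentiableAt : ∀ t > 0, ∀ θ ∈ Set.Ioo 0 (Real.pi / 2),
    DifferentiableAt ℝ (fun p : ℝ × ℝ => U p.1 p.2) (t, θ)
  eqn : ∀ t > 0, ∀ θ ∈ Set.Ioo 0 (Real.pi / 2),
    deriv (fun s => U s θ) t + A (U t) θ = 0
  initial : ∀ θ ∈ Set.Icc 0 (Real.pi / 2), U 0 θ = V₀ θ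

/-- The inverse Laplace transform of `ξ/(1+ξ)` times the Laplace transform of `m(t) = avg Θ₁(t)`.
As `ξ/(1+ξ) = 1 - 1/(1+ξ)`, this is `m(t) - ∫_0^t e^{-(t-s)} m(s) ds`. -/
def UpsilonOf (Θ : ℝ → ℝ → ℝ × ℝ) (t : ℝ) : ℝ :=
  avg (fun θ => (Θ t θ).1)
    - ∫ s in (0 : ℝ)..t, Real.exp (-(t - s)) * avg (fun θ => (Θ s θ).1)

end Angular

end

noncomputable section

namespace Angular

open MeasureTheory Set Filter Topology

/-! In the variable x = tan θ the operator 2D_θ becomes 4x∂_x, cos²θ becomes `wt x` = 1/(1+x²), and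
averages become integrals against (2/π) `wt`. Write f, g for the components of the evolution by L_θ
and m for the mean of f. Along the characteristics x e^{4t} the system is an ODE whose only nonlocal
input is m, and at the fixed point x = 0 it is a 2×2 system driven by the gap σ(t) = f(t,0) - m(t).
The proof shows that σ is small and then solves the system at x = 0.

To bound σ, divide f - f(t,0) and g - g(t,0) by X², X = x e^{4t} (`quot`). Since 1 - `wt` X = X²
`wt` X, the mean condition becomes a relation between σ, ∫ quot f and ∫ wt quot f. It makes the
moments P = ∫ quot f, Q = ∫ quot g obey the closed system P' = -14P + Q, Q' = 130P - 17Q, with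
eigenvalues -4 and -27. The slow mode is the one carried by the stationary profile Γ; subtracting
(237/46)Γ from the evolution removes it (`IsProfile.exists_isFlow`), and then P = e^{-27t}P(0)
(`IsFlow.integral_quot_eq`). An energy estimate gives e^{-8t} decay of ∫ (quot f² + quot g²/130)
(`IsFlow.energy_decay`), hence |σ| ≤ (10/3)e^{-2t} + 1.66 e^{-23t} (`IsFlow.abs_gap_le`).

The starting values P(0) and the initial energy depend on Γ, which is not explicit. Its quotients
are approximated by polynomials in `wt`, and a stationary energy estimate turns the residual into an
L² error bound (`IsSteady.exists_error`); the remaining integrals are rational multiples of π.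

Finally e^t Υ(t) = 237/23 + e^t m - ∫₀ᵗ e^s m ds. The combination f/5 + g/40 at x = 0 integrates e^s
m up to a multiple of e^s σ, so the bounds on σ, f(t,0), g(t,0) yield positivity once e^{-t} ≤ 1/4
(`IsProfile.upsilonOf_pos`). The evolution by 𝓛 reduces to that by L_θ through Duhamel's formula. -/

/-- `cos²θ` in the variable `x = tan θ`. -/
def wt (x : ℝ) : ℝ := (1 + x ^ 2)⁻¹

lemma wt_pos (x : ℝ) : 0 < wt x := by unfold wt; positivity

lemma wt_le_one (x : ℝ) : wt x ≤ 1 := by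
  unfold wt
  exact inv_le_one_of_one_le₀ (by nlinarith [sq_nonneg x])

lemma one_add_sq_mul_wt (x : ℝ) : (1 + x ^ 2) * wt x = 1 := by
  unfold wt
  exact mul_inv_cancel₀ (by positivity)

lemma sq_mul_wt (x : ℝ) : x ^ 2 * wt x = 1 - wt x := by
  linarith [one_add_sq_mul_wt x]

lemma continuous_wt : Continuous wt := by
  unfold wt
  exact Continuous.inv₀ (by fun_prop) (fun x => by positivity)

lemma hasDerivAt_wt (x : ℝ) : HasDerivAt wt (-2 * x * wt x ^ 2) x := by
  have h : HasDerivAt (fun y : ℝ => 1 + y ^ 2) (2 * x) x := by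
    simpa using (hasDerivAt_pow 2 x).const_add 1
  have := h.fun_inv (by positivity)
  unfold wt
  refine this.congr_deriv ?_
  rw [inv_pow]
  ring

/-! ### Integration on (0, ∞) of functions dominated by `wt`. -/

/-- Continuous functions on `(0, ∞)` that are `O(1 / (1 + x²))`. -/
def Decays (φ : ℝ → ℝ) : Prop :=
  ContinuousOn φ (Ioi 0) ∧ ∃ C, ∀ x > 0, |φ x| ≤ C * wt x

lemma integrable_wt : Integrable wt := integrable_inv_one_add_sq

namespace Decays

variable {φ ψ : ℝ → ℝ}

lemma integrableOn (h : Decays φ) : IntegrableOn φ (Ioi 0) := by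
  obtain ⟨hc, C, hC⟩ := h
  refine Integrable.mono' (g := fun x => C * wt x) (integrable_wt.const_mul C).integrableOn
    (hc.aestronglyMeasurable measurableSet_Ioi) ?_
  filter_upwards [ae_restrict_mem measurableSet_Ioi] with x hx
  simpa using hC x hx

lemma wt : Decays wt :=
  ⟨continuous_wt.continuousOn, 1, fun x _ => by rw [abs_of_pos (wt_pos x), one_mul]⟩

lemma add (h : Decays φ) (k : Decays ψ) : Decays (fun x => φ x + ψ x) := by
  obtain ⟨hc, C, hC⟩ := h
  obtain ⟨kc, K, hK⟩ := k
  refine ⟨hc.add kc, C + K, fun x hx => ?_⟩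
  calc |φ x + ψ x| ≤ |φ x| + |ψ x| := abs_add_le _ _
    _ ≤ _ := by linarith [hC x hx, hK x hx]

/-- The product with a bounded continuous function. -/
lemma bdd_mul (h : Decays φ) (hψ : ContinuousOn ψ (Ioi 0)) {M : ℝ} (hM : ∀ x > 0, |ψ x| ≤ M) :
    Decays (fun x => ψ x * φ x) := by
  obtain ⟨hc, C, hC⟩ := h
  refine ⟨hψ.mul hc, M * C, fun x hx => ?_⟩
  rw [abs_mul, mul_assoc]
  exact mul_le_mul (hM x hx) (hC x hx) (abs_nonneg _) ((abs_nonneg _).trans (hM x hx))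

lemma const_mul (h : Decays φ) (c : ℝ) : Decays (fun x => c * φ x) :=
  h.bdd_mul continuousOn_const (M := |c|) (fun _ _ => le_rfl)

lemma congr (h : Decays φ) (e : ∀ x, φ x = ψ x) : Decays ψ := by
  rwa [← funext e]

lemma sub (h : Decays φ) (k : Decays ψ) : Decays (fun x => φ x - ψ x) :=
  (h.add (k.const_mul (-1))).congr fun x => by ring

lemma bounded (h : Decays φ) : ∃ M, ∀ x > 0, |φ x| ≤ M := by
  obtain ⟨-, C, hC⟩ := h
  refine ⟨|C|, fun x hx => (hC x hx).trans ?_⟩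
  have h1 := wt_pos x
  have h2 := wt_le_one x
  nlinarith [le_abs_self C, abs_nonneg C]

lemma mul (h : Decays φ) (k : Decays ψ) : Decays (fun x => φ x * ψ x) := by
  obtain ⟨M, hM⟩ := h.bounded
  exact k.bdd_mul h.1 hM

lemma sq (h : Decays φ) : Decays (fun x => φ x ^ 2) :=
  (h.mul h).congr (fun x => by ring)

lemma wt_mul (h : Decays φ) : Decays (fun x => Angular.wt x * φ x) :=
  Decays.wt.mul h

/-- Integration by parts for the Euler operator `x ∂_x`. -/
lemma integral_add_euler (h : Decays φ) (k : Decays ψ)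
    (hd : ∀ x > 0, HasDerivAt φ (ψ x / x) x) :
    (∫ x in Ioi 0, φ x) + ∫ x in Ioi 0, ψ x = 0 := by
  obtain ⟨C, hC⟩ := h.2
  have hC0 : ∀ x > 0, |x * φ x| ≤ C * |x| := fun x hx => by
    rw [abs_mul, mul_comm]
    refine mul_le_mul_of_nonneg_right ?_ (abs_nonneg _)
    have h1 := wt_pos x
    have h2 := wt_le_one x
    have h3 := hC x hx
    have h4 : 0 ≤ C := by
      by_contra hneg
      have := abs_nonneg (φ x)
      nlinarith
    nlinarith
  have hinf : ∀ x > 0, |x * φ x| ≤ C * x⁻¹ := fun x hx => by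
    have h3 := hC x hx
    have h5 := sq_mul_wt x
    have h1 := wt_pos x
    have h4 : 0 ≤ C := by
      by_contra hneg
      have := abs_nonneg (φ x)
      nlinarith
    rw [abs_mul, abs_of_pos hx]
    have : x * (x * |φ x|) ≤ C := by
      have : x ^ 2 * |φ x| ≤ x ^ 2 * (C * Angular.wt x) := by gcongr
      nlinarith
    rw [← div_eq_mul_inv, le_div_iff₀ hx]
    linarith
  have key := integral_Ioi_of_hasDerivAt_of_tendsto (a := (0 : ℝ)) (m := 0)
    (f := fun x => x * φ x) (f' := fun x => φ x + ψ x) ?_ ?_ (h.add k).integrableOn ?_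
  · rw [integral_add h.integrableOn k.integrableOn] at key
    simpa using key
  · have : Tendsto (fun x => x * φ x) (𝓝[Ici 0] 0) (𝓝 0) := by
      refine squeeze_zero_norm' (a := fun x => C * |x|) ?_ ?_
      · filter_upwards [self_mem_nhdsWithin] with x hx
        rcases (mem_Ici.1 hx).eq_or_lt with rfl | hx
        · simp
        · exact hC0 x hx
      · have : Continuous (fun x : ℝ => C * |x|) := by fun_prop
        have := (this.tendsto 0).mono_left (nhdsWithin_le_nhds (s := Ici 0))
        simpa using this
    unfold ContinuousWithinAt
    simpa using this
  · intro x hx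
    have := (hasDerivAt_id x).mul (hd x hx)
    refine this.congr_deriv ?_
    have : x ≠ 0 := (mem_Ioi.1 hx).ne'
    change 1 * φ x + x * (ψ x / x) = φ x + ψ x
    field_simp
  · refine squeeze_zero_norm' (a := fun x => C * x⁻¹) ?_ ?_
    · filter_upwards [eventually_gt_atTop 0] with x hx
      exact hinf x hx
    · simpa using tendsto_inv_atTop_zero.const_mul C

/-- Cauchy–Schwarz. -/
lemma sq_integral_mul_le (h : Decays φ) (k : Decays ψ) :
    (∫ x in Ioi 0, φ x * ψ x) ^ 2 ≤ (∫ x in Ioi 0, φ x ^ 2) * ∫ x in Ioi 0, ψ x ^ 2 := by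
  have key : ∀ s : ℝ, 0 ≤ (∫ x in Ioi 0, φ x ^ 2) * (s * s)
      + (2 * ∫ x in Ioi 0, φ x * ψ x) * s + ∫ x in Ioi 0, ψ x ^ 2 := fun s => by
    have h1 : 0 ≤ ∫ x in Ioi 0, (s * φ x + ψ x) ^ 2 := integral_nonneg (fun x => sq_nonneg _)
    have h2 : ∫ x in Ioi 0, (s * φ x + ψ x) ^ 2
        = ∫ x in Ioi 0, ((s * s) * φ x ^ 2 + (2 * s) * (φ x * ψ x)) + ψ x ^ 2 := by
      congr 1; ext x; ring
    rw [h2, integral_add ((h.sq.const_mul _).add ((h.mul k).const_mul _)).integrableOn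
      k.sq.integrableOn, integral_add (h.sq.const_mul _).integrableOn
      ((h.mul k).const_mul _).integrableOn, integral_const_mul, integral_const_mul] at h1
    linarith
  have := discrim_le_zero key
  unfold discrim at this
  nlinarith

end Decays

/-! ### Exact moments of polynomials in `wt`. -/

lemma integral_wt : ∫ x in Ioi 0, wt x = Real.pi / 2 := by
  unfold wt
  simp

/-- The normalized moments `(2/π) ∫_0^∞ wt^(n+1)`. -/
def wtMoment : ℕ → ℚ
  | 0 => 1
  | n + 1 => (2 * n + 1) / (2 * n + 2) * wtMoment n

lemma Decays.wt_pow (n : ℕ) : Decays (fun x => Angular.wt x ^ (n + 1)) := by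
  induction n with
  | zero => simpa using Decays.wt
  | succ n ih => exact (ih.mul Decays.wt).congr (fun x => by ring)

/-- The recurrence is Euler integration by parts for wt^(n+1), because x ∂_x wt^(n+1) =
-2(n+1)(wt^(n+1) - wt^(n+2)). -/
lemma integral_wt_pow (n : ℕ) :
    ∫ x in Ioi 0, wt x ^ (n + 1) = Real.pi / 2 * wtMoment n := by
  induction n with
  | zero => simp [integral_wt, wtMoment]
  | succ n ih =>
    have h1 : Decays (fun x => -(2 * (n + 1)) * wt x ^ (n + 1) + (2 * (n + 1)) * wt x ^ (n + 2)) :=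
      ((Decays.wt_pow n).const_mul _).add ((Decays.wt_pow (n + 1)).const_mul _)
    have := (Decays.wt_pow n).integral_add_euler h1 (fun x hx => by
      refine ((hasDerivAt_wt x).fun_pow (n + 1)).congr_deriv ?_
      have hx' : x ≠ 0 := hx.ne'
      have h := sq_mul_wt x
      field_simp
      push_cast
      linear_combination (-((n : ℝ) + 1) * wt x ^ (n + 1)) * h)
    rw [integral_add ((Decays.wt_pow n).const_mul _).integrableOn
      ((Decays.wt_pow (n + 1)).const_mul _).integrableOn, integral_const_mul,
      integral_const_mul, ih] at this
    rw [wtMoment]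
    push_cast
    have h2 : (2 * (n : ℝ) + 2) ≠ 0 := by positivity
    have h3 : ∫ x in Ioi 0, wt x ^ (n + 1 + 1)
        = Real.pi / 2 * ((2 * n + 1) * wtMoment n) / (2 * n + 2) := by
      rw [eq_div_iff h2]
      linear_combination this
    rw [h3]
    ring

/-- A linear combination of the powers `wt, wt², …`. -/
def wtPoly (l : List ℚ) (x : ℝ) : ℝ :=
  wt x * l.foldr (fun (c : ℚ) (r : ℝ) => (c : ℝ) + wt x * r) 0

lemma wtPoly_nil (x : ℝ) : wtPoly [] x = 0 := by simp [wtPoly]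

lemma wtPoly_cons (c : ℚ) (l : List ℚ) (x : ℝ) :
    wtPoly (c :: l) x = c * wt x + wt x * wtPoly l x := by
  simp only [wtPoly, List.foldr_cons]; ring

/-- `∑ c_j wtMoment (k + j)`. -/
def momentSum : ℕ → List ℚ → ℚ
  | _, [] => 0
  | k, c :: l => c * wtMoment k + momentSum (k + 1) l

/-- Reduces every integral of a trial polynomial to rational arithmetic; the free exponent k makes
the induction on the list go through. -/
lemma integral_wt_pow_mul_wtPoly (l : List ℚ) : ∀ k : ℕ,
    Decays (fun x => wt x ^ k * wtPoly l x) ∧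
    ∫ x in Ioi 0, wt x ^ k * wtPoly l x = Real.pi / 2 * momentSum k l := by
  induction l with
  | nil =>
    intro k
    simp only [wtPoly_nil, mul_zero, momentSum, Rat.cast_zero, integral_zero, and_true]
    exact ⟨continuousOn_const, 0, fun x _ => by simp⟩
  | cons c l ih =>
    intro k
    obtain ⟨h1, h2⟩ := ih (k + 1)
    have h3 : ∀ x, wt x ^ k * wtPoly (c :: l) x
        = c * wt x ^ (k + 1) + wt x ^ (k + 1) * wtPoly l x := fun x => by
      rw [wtPoly_cons]; ring
    have h4 := (Decays.wt_pow k).const_mul (c : ℝ)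
    refine ⟨(h4.add h1).congr fun x => (h3 x).symm, ?_⟩
    simp_rw [h3]
    rw [integral_add h4.integrableOn h1.integrableOn, integral_const_mul, integral_wt_pow, h2,
      momentSum]
    push_cast
    ring

lemma Decays.wtPoly (l : List ℚ) : Decays (Angular.wtPoly l) := by
  simpa using (integral_wt_pow_mul_wtPoly l 0).1

lemma integral_wtPoly (l : List ℚ) :
    ∫ x in Ioi 0, wtPoly l x = Real.pi / 2 * momentSum 0 l := by
  simpa using (integral_wt_pow_mul_wtPoly l 0).2

/-! ### Monotonicity on [0, ∞) and parametric integrals. -/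

lemma antitoneOn_Ici_of_hasDerivAt {φ φ' : ℝ → ℝ} (hc : ContinuousOn φ (Ici 0))
    (hd : ∀ t > 0, HasDerivAt φ (φ' t) t) (hn : ∀ t > 0, φ' t ≤ 0) : AntitoneOn φ (Ici 0) := by
  refine antitoneOn_of_deriv_nonpos (convex_Ici 0) hc ?_ ?_
  · rw [interior_Ici]
    exact fun t ht => (hd t ht).differentiableAt.differentiableWithinAt
  · rw [interior_Ici]
    intro t ht
    rw [(hd t ht).deriv]
    exact hn t ht

lemma eq_of_hasDerivAt_zero {φ : ℝ → ℝ} (hc : ContinuousOn φ (Ici 0))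
    (hd : ∀ t > 0, HasDerivAt φ 0 t) {t : ℝ} (ht : 0 ≤ t) : φ t = φ 0 := by
  have h1 := antitoneOn_Ici_of_hasDerivAt hc hd (fun _ _ => le_rfl)
  have h2 := antitoneOn_Ici_of_hasDerivAt (φ := fun t => - φ t) hc.neg
    (fun t ht => (hd t ht).fun_neg) (fun _ _ => by simp)
  have h3 := h1 (mem_Ici.2 le_rfl) (mem_Ici.2 ht) ht
  have h4 := h2 (mem_Ici.2 le_rfl) (mem_Ici.2 ht) ht
  simp only at h4
  linarith

lemma le_of_hasDerivAt_nonneg {φ φ' : ℝ → ℝ} (hc : ContinuousOn φ (Ici 0))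
    (hd : ∀ t > 0, HasDerivAt φ (φ' t) t) (hn : ∀ t > 0, 0 ≤ φ' t) {t : ℝ} (ht : 0 ≤ t) :
    φ 0 ≤ φ t := by
  have h2 := antitoneOn_Ici_of_hasDerivAt (φ := fun t => - φ t) hc.neg
    (fun t ht => (hd t ht).fun_neg) (fun t ht => by linarith [hn t ht])
  have h4 := h2 (mem_Ici.2 le_rfl) (mem_Ici.2 ht) ht
  simp only at h4
  linarith

/-- Differentiation under the integral sign, for families uniformly dominated by `wt`. -/
lemma hasDerivAt_integral_of_wt_bound {F F' : ℝ → ℝ → ℝ} {C T : ℝ}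
    (hF : ∀ t ∈ Ioo 0 T, Decays (F t)) (hF' : ∀ t ∈ Ioo 0 T, ContinuousOn (F' t) (Ioi 0))
    (hb : ∀ t ∈ Ioo 0 T, ∀ x > 0, |F' t x| ≤ C * wt x)
    (hd : ∀ t ∈ Ioo 0 T, ∀ x > 0, HasDerivAt (fun s => F s x) (F' t x) t)
    {t : ℝ} (ht : t ∈ Ioo 0 T) :
    HasDerivAt (fun s => ∫ x in Ioi 0, F s x) (∫ x in Ioi 0, F' t x) t := by
  refine (hasDerivAt_integral_of_dominated_loc_of_deriv_le (bound := fun x => C * wt x)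
    (s := Ioo 0 T) (Ioo_mem_nhds ht.1 ht.2) ?_ (hF t ht).integrableOn
    ((hF' t ht).aestronglyMeasurable measurableSet_Ioi) ?_
    (integrable_wt.const_mul C).integrableOn ?_).2
  · filter_upwards [Ioo_mem_nhds ht.1 ht.2] with s hs
    exact (hF s hs).1.aestronglyMeasurable measurableSet_Ioi
  · filter_upwards [ae_restrict_mem measurableSet_Ioi] with x hx s hs
    exact hb s hs x hx
  · filter_upwards [ae_restrict_mem measurableSet_Ioi] with x hx s hs
    exact hd s hs x hx

lemma continuousOn_integral_of_wt_bound {F : ℝ → ℝ → ℝ} {C T : ℝ}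
    (hF : ∀ t ∈ Icc 0 T, ContinuousOn (F t) (Ioi 0))
    (hb : ∀ t ∈ Icc 0 T, ∀ x > 0, |F t x| ≤ C * wt x)
    (hc : ∀ x > 0, ContinuousOn (fun s => F s x) (Icc 0 T)) :
    ContinuousOn (fun s => ∫ x in Ioi 0, F s x) (Icc 0 T) := by
  refine continuousOn_of_dominated (bound := fun x => C * wt x)
    (fun t ht => (hF t ht).aestronglyMeasurable measurableSet_Ioi) ?_
    (integrable_wt.const_mul C).integrableOn ?_
  · intro t ht
    filter_upwards [ae_restrict_mem measurableSet_Ioi] with x hx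
    exact hb t ht x hx
  · filter_upwards [ae_restrict_mem measurableSet_Ioi] with x hx
    exact hc x hx

/-! ### Change of variable x = tan θ and characteristics. -/

lemma avg_eq_integral_arctan (f : ℝ → ℝ) :
    ∫ x in Ioi 0, wt x * f (Real.arctan x) = Real.pi / 2 * avg f := by
  have himg : Real.arctan '' Ioi 0 = Ioo 0 (Real.pi / 2) := by
    ext θ
    constructor
    · rintro ⟨x, hx, rfl⟩
      exact ⟨Real.arctan_pos.2 hx, Real.arctan_lt_pi_div_two x⟩
    · rintro ⟨h0, h1⟩
      exact ⟨Real.tan θ, Real.tan_pos_of_pos_of_lt_pi_div_two h0 h1,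
        Real.arctan_tan (by linarith [Real.pi_pos]) h1⟩
  have h := integral_image_eq_integral_abs_deriv_smul (s := Ioi (0 : ℝ)) (f := Real.arctan)
    (f' := wt) measurableSet_Ioi
    (fun x _ => by simpa [wt] using (Real.hasDerivAt_arctan x).hasDerivWithinAt)
    Real.arctan_injective.injOn f
  rw [himg] at h
  have h2 : ∫ θ in (0 : ℝ)..(Real.pi / 2), f θ = ∫ θ in Ioo 0 (Real.pi / 2), f θ := by
    rw [intervalIntegral.integral_of_le (by positivity), integral_Ioc_eq_integral_Ioo]
  rw [avg, h2, h]
  have : Real.pi ≠ 0 := Real.pi_ne_zero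
  have h3 : ∀ x, |wt x| • f (Real.arctan x) = wt x * f (Real.arctan x) := fun x => by
    rw [abs_of_pos (wt_pos x), smul_eq_mul]
  simp_rw [h3]
  field_simp

/-- Solutions of `∂_t U + L_θ U = 0` in the variable `x = tan θ`, along the trajectories
`x e^{4t}`; `m` stands for the average of the first component. -/
structure IsFlow (f g : ℝ → ℝ → ℝ) (m : ℝ → ℝ) : Prop where
  cont_fst : Continuous (fun p : ℝ × ℝ => f p.1 p.2)
  cont_snd : Continuous (fun p : ℝ × ℝ => g p.1 p.2)
  cont_mean : Continuous m
  bounded : ∀ T, ∃ M, ∀ t ∈ Icc 0 T, ∀ x, |f t x| ≤ M ∧ |g t x| ≤ M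
  mean_eq : ∀ t ≥ 0, ∫ x in Ioi 0, wt x * f t x = Real.pi / 2 * m t
  deriv_fst : ∀ t > 0, ∀ x > 0, HasDerivAt (fun s => f s (x * Real.exp (4 * s)))
    (-6 * f t (x * Real.exp (4 * t)) + g t (x * Real.exp (4 * t))) t
  deriv_snd : ∀ t > 0, ∀ x > 0, HasDerivAt (fun s => g s (x * Real.exp (4 * s)))
    (-9 * g t (x * Real.exp (4 * t))
      + 130 * wt (x * Real.exp (4 * t)) * (f t (x * Real.exp (4 * t)) - m t)) t

lemma hasDerivAt_fst {u : ℝ → ℝ × ℝ} {v : ℝ × ℝ} {t : ℝ} (h : HasDerivAt u v t) :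
    HasDerivAt (fun s => (u s).1) v.1 t :=
  (ContinuousLinearMap.fst ℝ ℝ ℝ).hasFDerivAt.comp_hasDerivAt t h

lemma hasDerivAt_snd {u : ℝ → ℝ × ℝ} {v : ℝ × ℝ} {t : ℝ} (h : HasDerivAt u v t) :
    HasDerivAt (fun s => (u s).2) v.2 t :=
  (ContinuousLinearMap.snd ℝ ℝ ℝ).hasFDerivAt.comp_hasDerivAt t h

lemma arctan_abs_mem (x : ℝ) : Real.arctan |x| ∈ Icc 0 (Real.pi / 2) :=
  ⟨Real.arctan_nonneg.2 (abs_nonneg x), (Real.arctan_lt_pi_div_two _).le⟩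

lemma sin_two_mul_arctan (x : ℝ) : Real.sin (2 * Real.arctan x) = 2 * x * wt x := by
  have h1 : 0 < 1 + x ^ 2 := by positivity
  rw [Real.sin_two_mul, Real.sin_arctan, Real.cos_arctan, wt]
  field_simp
  rw [Real.sq_sqrt h1.le]

/-- The curves x e^{4t} are the characteristics of ∂_t + 2 sin(2θ) ∂_θ, so the transport term
disappears along them. -/
lemma hasDerivAt_arctan_trajectory (x t : ℝ) :
    HasDerivAt (fun s => Real.arctan (x * Real.exp (4 * s)))
      (2 * Real.sin (2 * Real.arctan (x * Real.exp (4 * t)))) t := by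
  have h1 : HasDerivAt (fun s : ℝ => x * Real.exp (4 * s)) (x * (Real.exp (4 * t) * 4)) t := by
    have : HasDerivAt (fun s : ℝ => 4 * s) 4 t := by simpa using (hasDerivAt_id t).const_mul 4
    exact this.exp.const_mul x
  refine h1.arctan.congr_deriv ?_
  rw [sin_two_mul_arctan, wt]
  ring

lemma IsEvolution.continuous_comp {A : (ℝ → ℝ × ℝ) → ℝ → ℝ × ℝ} {V₀ : ℝ → ℝ × ℝ}
    {U : ℝ → ℝ → ℝ × ℝ} (h : IsEvolution A V₀ U) {X : Type*} [TopologicalSpace X]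
    {τ φ : X → ℝ} (hτ : Continuous τ) (hφ : Continuous φ)
    (hm : ∀ x, φ x ∈ Icc 0 (Real.pi / 2)) :
    Continuous (fun x => U (max (τ x) 0) (φ x)) :=
  h.continuousOn.comp_continuous (f := fun x => (max (τ x) 0, φ x)) (by fun_prop)
    (fun x => ⟨mem_Ici.2 (le_max_right _ _), hm x⟩)

lemma IsEvolution.continuous_avg {A : (ℝ → ℝ × ℝ) → ℝ → ℝ × ℝ} {V₀ : ℝ → ℝ × ℝ}
    {U : ℝ → ℝ → ℝ × ℝ} (h : IsEvolution A V₀ U) :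
    Continuous (fun t => avg (fun θ => (U (max t 0) θ).1)) := by
  have hpi := Real.pi_pos
  have h1 : ∀ t, ∫ θ in (0 : ℝ)..(Real.pi / 2), (U (max t 0) θ).1
      = ∫ θ in (0 : ℝ)..(Real.pi / 2), (U (max t 0) (max 0 (min θ (Real.pi / 2)))).1 := by
    intro t
    refine intervalIntegral.integral_congr (fun θ hθ => ?_)
    rw [uIcc_of_le (by positivity)] at hθ
    simp only [min_eq_left hθ.2, max_eq_right hθ.1]
  simp only [avg, h1]
  refine continuous_const.mul
    (intervalIntegral.continuous_parametric_intervalIntegral_of_continuous' ?_ _ _)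
  exact (h.continuous_comp (X := ℝ × ℝ) (τ := Prod.fst)
    (φ := fun p => max 0 (min p.2 (Real.pi / 2))) (by fun_prop) (by fun_prop)
    (fun p => ⟨le_max_left _ _, max_le (by positivity) (min_le_right _ _)⟩)).fst

lemma IsEvolution.hasDerivAt_trajectory {A : (ℝ → ℝ × ℝ) → ℝ → ℝ × ℝ} {V₀ : ℝ → ℝ × ℝ}
    {U : ℝ → ℝ → ℝ × ℝ} (h : IsEvolution A V₀ U) {t x : ℝ} (ht : 0 < t) (hx : 0 < x) :
    HasDerivAt (fun s => U s (Real.arctan (x * Real.exp (4 * s))))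
      (-A (U t) (Real.arctan (x * Real.exp (4 * t)))
        + (2 * Real.sin (2 * Real.arctan (x * Real.exp (4 * t)))) •
          deriv (U t) (Real.arctan (x * Real.exp (4 * t)))) t
    ∧ DifferentiableAt ℝ (U t) (Real.arctan (x * Real.exp (4 * t))) := by
  set θ := Real.arctan (x * Real.exp (4 * t)) with hθ
  have hmem : θ ∈ Ioo 0 (Real.pi / 2) :=
    ⟨Real.arctan_pos.2 (by positivity), Real.arctan_lt_pi_div_two _⟩
  have hd := (h.differentiableAt t ht θ hmem).hasFDerivAt
  set L := fderiv ℝ (fun p : ℝ × ℝ => U p.1 p.2) (t, θ) with hL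
  have h1 : HasDerivAt (fun s => U s θ) (L (1, 0)) t := by
    have := hd.comp_hasDerivAt t (f := fun s => (s, θ)) ((hasDerivAt_id t).prodMk
      (hasDerivAt_const t θ))
    exact this
  have h2 : HasDerivAt (U t) (L (0, 1)) θ := by
    have := hd.comp_hasDerivAt θ (f := fun s => (t, s)) ((hasDerivAt_const θ t).prodMk
      (hasDerivAt_id θ))
    exact this
  refine ⟨?_, h2.differentiableAt⟩
  have h3 := hd.comp_hasDerivAt t (f := fun s => (s, Real.arctan (x * Real.exp (4 * s))))
    ((hasDerivAt_id t).prodMk (hasDerivAt_arctan_trajectory x t))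
  refine h3.congr_deriv ?_
  have e := h.eqn t ht θ hmem
  rw [h1.deriv] at e
  rw [h2.deriv, ← hθ, ← eq_neg_of_add_eq_zero_left e, ← map_smul, ← map_add]
  congr 1
  simp

/-- The arguments max t 0 and |x| extend the solution to a globally continuous function without
changing it for t ≥ 0, x ≥ 0. -/
lemma IsEvolution.isFlow {V₀ : ℝ → ℝ × ℝ} {U : ℝ → ℝ → ℝ × ℝ}
    (h : IsEvolution Ltheta V₀ U) :
    IsFlow (fun t x => (U (max t 0) (Real.arctan |x|)).1)
      (fun t x => (U (max t 0) (Real.arctan |x|)).2)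
      (fun t => avg (fun θ => (U (max t 0) θ).1)) := by
  have hc : Continuous (fun p : ℝ × ℝ => U (max p.1 0) (Real.arctan |p.2|)) :=
    h.continuous_comp (by fun_prop) (Real.continuous_arctan.comp (by fun_prop))
      (fun p => arctan_abs_mem p.2)
  have hev : ∀ t > 0, ∀ x > 0, (fun s => U (max s 0) (Real.arctan |x * Real.exp (4 * s)|))
      =ᶠ[𝓝 t] fun s => U s (Real.arctan (x * Real.exp (4 * s))) := fun t ht x hx => by
    filter_upwards [Ioi_mem_nhds ht] with s hs
    rw [max_eq_left (mem_Ioi.1 hs).le, abs_of_pos (by positivity)]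
  refine ⟨hc.fst, hc.snd, h.continuous_avg, ?_, ?_, ?_, ?_⟩
  · intro T
    have hK : IsCompact (Icc (0 : ℝ) T ×ˢ Icc (0 : ℝ) (Real.pi / 2)) :=
      isCompact_Icc.prod isCompact_Icc
    obtain ⟨M, hM⟩ := hK.exists_bound_of_continuousOn
      (h.continuousOn.mono (prod_mono Icc_subset_Ici_self le_rfl))
    refine ⟨M, fun t ht x => ?_⟩
    have := hM (t, Real.arctan |x|) ⟨ht, arctan_abs_mem x⟩
    rw [max_eq_left ht.1]
    exact ⟨(norm_fst_le _).trans this, (norm_snd_le _).trans this⟩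
  · intro t _
    rw [← avg_eq_integral_arctan]
    refine setIntegral_congr_fun measurableSet_Ioi (fun x hx => ?_)
    simp only [abs_of_pos (mem_Ioi.1 hx)]
  · intro t ht x hx
    obtain ⟨h1, h2⟩ := h.hasDerivAt_trajectory ht hx
    have h3 := hasDerivAt_fst (h1.congr_of_eventuallyEq (hev t ht x hx))
    have h4 : deriv (fun s => (U t s).1) (Real.arctan (x * Real.exp (4 * t)))
        = (deriv (U t) (Real.arctan (x * Real.exp (4 * t)))).1 := (hasDerivAt_fst h2.hasDerivAt).deriv
    refine h3.congr_deriv ?_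
    rw [max_eq_left ht.le, abs_of_pos (by positivity)]
    simp only [Ltheta, D, h4, Prod.fst_add, Prod.fst_neg, Prod.smul_fst, smul_eq_mul]
    ring
  · intro t ht x hx
    obtain ⟨h1, h2⟩ := h.hasDerivAt_trajectory ht hx
    have h3 := hasDerivAt_snd (h1.congr_of_eventuallyEq (hev t ht x hx))
    have h4 : deriv (fun s => (U t s).2) (Real.arctan (x * Real.exp (4 * t)))
        = (deriv (U t) (Real.arctan (x * Real.exp (4 * t)))).2 := (hasDerivAt_snd h2.hasDerivAt).deriv
    refine h3.congr_deriv ?_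
    rw [max_eq_left ht.le, abs_of_pos (by positivity)]
    simp only [Ltheta, D, h4, Prod.snd_add, Prod.snd_neg, Prod.smul_snd, smul_eq_mul,
      Real.cos_sq_arctan, wt, one_div]
    ring

lemma IsProfile.isEvolution {Γ : ℝ → ℝ × ℝ} (h : IsProfile Γ) :
    IsEvolution Ltheta Γ (fun _ => Γ) := by
  refine ⟨h.continuousOn.comp continuousOn_snd (fun p hp => hp.2), ?_, ?_, fun _ _ => rfl⟩
  · intro t _ θ hθ
    exact (h.differentiableAt θ hθ).comp (t, θ) differentiableAt_snd
  · intro t _ θ hθ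
    rw [h.eqn θ hθ]
    simp

lemma IsFlow.continuous_fst_apply {f g : ℝ → ℝ → ℝ} {m : ℝ → ℝ} (h : IsFlow f g m) (t : ℝ) :
    Continuous (f t) :=
  h.cont_fst.comp (by fun_prop : Continuous fun x : ℝ => (t, x))

lemma IsFlow.decays_wt_mul_fst {f g : ℝ → ℝ → ℝ} {m : ℝ → ℝ} (h : IsFlow f g m) {t : ℝ}
    (ht : 0 ≤ t) : Decays (fun x => wt x * f t x) := by
  obtain ⟨M, hM⟩ := h.bounded t
  exact (Decays.wt.bdd_mul (h.continuous_fst_apply t).continuousOn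
    (fun x _ => (hM t ⟨ht, le_rfl⟩ x).1)).congr (fun x => mul_comm _ _)

lemma IsFlow.sub_smul {f g f' g' : ℝ → ℝ → ℝ} {m m' : ℝ → ℝ} (h : IsFlow f g m)
    (h' : IsFlow f' g' m') (c : ℝ) :
    IsFlow (fun t x => f t x - c * f' t x) (fun t x => g t x - c * g' t x)
      (fun t => m t - c * m' t) := by
  refine ⟨h.cont_fst.sub (h'.cont_fst.const_mul c), h.cont_snd.sub (h'.cont_snd.const_mul c),
    h.cont_mean.sub (h'.cont_mean.const_mul c), ?_, ?_, ?_, ?_⟩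
  · intro T
    obtain ⟨M, hM⟩ := h.bounded T
    obtain ⟨M', hM'⟩ := h'.bounded T
    have key : ∀ a b : ℝ, |a| ≤ M → |b| ≤ M' → |a - c * b| ≤ M + |c| * M' := fun a b ha hb => by
      calc |a - c * b| ≤ |a| + |c * b| := abs_sub _ _
        _ ≤ _ := by rw [abs_mul]; gcongr
    exact ⟨M + |c| * M', fun t ht x => ⟨key _ _ (hM t ht x).1 (hM' t ht x).1,
      key _ _ (hM t ht x).2 (hM' t ht x).2⟩⟩
  · intro t ht
    simp only [mul_sub]
    have h2 : ∀ x, wt x * (c * f' t x) = c * (wt x * f' t x) := fun x => by ring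
    simp_rw [h2]
    rw [integral_sub (h.decays_wt_mul_fst ht).integrableOn
      ((h'.decays_wt_mul_fst ht).const_mul c).integrableOn, integral_const_mul,
      h.mean_eq t ht, h'.mean_eq t ht]
    ring
  · intro t ht x hx
    refine ((h.deriv_fst t ht x hx).sub ((h'.deriv_fst t ht x hx).const_mul c)).congr_deriv ?_
    ring
  · intro t ht x hx
    refine ((h.deriv_snd t ht x hx).sub ((h'.deriv_snd t ht x hx).const_mul c)).congr_deriv ?_
    ring

/-! ### Families dominated by `wt` locally uniformly in time. -/

/-- Families of functions on `(0, ∞)` that are `O(1 / (1 + x²))` locally uniformly in time. -/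
def UnifDecays (F : ℝ → ℝ → ℝ) : Prop :=
  (∀ t ≥ 0, ContinuousOn (F t) (Ioi 0)) ∧
    ∀ T, ∃ C, ∀ t ∈ Icc 0 T, ∀ x > 0, |F t x| ≤ C * wt x

/-- Families of functions on `(0, ∞)` that are bounded locally uniformly in time. -/
def UnifBdd (F : ℝ → ℝ → ℝ) : Prop :=
  (∀ t ≥ 0, ContinuousOn (F t) (Ioi 0)) ∧
    ∀ T, ∃ C, ∀ t ∈ Icc 0 T, ∀ x > 0, |F t x| ≤ C

namespace UnifDecays

variable {F G : ℝ → ℝ → ℝ}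

lemma decays (h : UnifDecays F) {t : ℝ} (ht : 0 ≤ t) : Decays (F t) := by
  obtain ⟨C, hC⟩ := h.2 t
  exact ⟨h.1 t ht, C, hC t ⟨ht, le_rfl⟩⟩

lemma unifBdd (h : UnifDecays F) : UnifBdd F := by
  refine ⟨h.1, fun T => ?_⟩
  obtain ⟨C, hC⟩ := h.2 T
  refine ⟨|C|, fun t ht x hx => (hC t ht x hx).trans ?_⟩
  have h1 := wt_pos x
  have h2 := wt_le_one x
  nlinarith [le_abs_self C, abs_nonneg C]

lemma bdd_mul (h : UnifDecays F) (k : UnifBdd G) : UnifDecays (fun t x => G t x * F t x) := by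
  refine ⟨fun t ht => (k.1 t ht).mul (h.1 t ht), fun T => ?_⟩
  obtain ⟨C, hC⟩ := h.2 T
  obtain ⟨M, hM⟩ := k.2 T
  refine ⟨M * C, fun t ht x hx => ?_⟩
  rw [abs_mul, mul_assoc]
  exact mul_le_mul (hM t ht x hx) (hC t ht x hx) (abs_nonneg _)
    ((abs_nonneg _).trans (hM t ht x hx))

lemma add (h : UnifDecays F) (k : UnifDecays G) : UnifDecays (fun t x => F t x + G t x) := by
  refine ⟨fun t ht => (h.1 t ht).add (k.1 t ht), fun T => ?_⟩
  obtain ⟨C, hC⟩ := h.2 T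
  obtain ⟨K, hK⟩ := k.2 T
  refine ⟨C + K, fun t ht x hx => ?_⟩
  calc |F t x + G t x| ≤ |F t x| + |G t x| := abs_add_le _ _
    _ ≤ _ := by linarith [hC t ht x hx, hK t ht x hx]

lemma const_mul (h : UnifDecays F) (c : ℝ) : UnifDecays (fun t x => c * F t x) :=
  h.bdd_mul ⟨fun _ _ => continuousOn_const, fun _ => ⟨|c|, fun _ _ _ _ => le_rfl⟩⟩

lemma mul (h : UnifDecays F) (k : UnifDecays G) : UnifDecays (fun t x => F t x * G t x) :=
  k.bdd_mul h.unifBdd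

lemma congr (h : UnifDecays F) (e : ∀ t x, F t x = G t x) : UnifDecays G := by
  rwa [← funext fun t => funext (e t)]

/-- Integrals of uniformly dominated families are continuous and may be differentiated under the
integral sign. -/
lemma continuousOn_and_hasDerivAt_integral {F' : ℝ → ℝ → ℝ} (h : UnifDecays F)
    (h' : UnifDecays F') (hc : ∀ x > 0, ContinuousOn (fun t => F t x) (Ici 0))
    (hd : ∀ t > 0, ∀ x > 0, HasDerivAt (fun s => F s x) (F' t x) t) :
    ContinuousOn (fun t => ∫ x in Ioi 0, F t x) (Ici 0) ∧
      ∀ t > 0, HasDerivAt (fun s => ∫ x in Ioi 0, F s x) (∫ x in Ioi 0, F' t x) t := by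
  constructor
  · intro t ht
    obtain ⟨C, hC⟩ := h.2 (t + 1)
    have h1 := continuousOn_integral_of_wt_bound (F := F) (T := t + 1)
      (fun s hs => h.1 s hs.1) hC (fun x hx => (hc x hx).mono Icc_subset_Ici_self)
    refine (h1 t ⟨ht, by linarith⟩).mono_of_mem_nhdsWithin ?_
    have : Ici (0 : ℝ) ∩ Iio (t + 1) ∈ 𝓝[Ici 0] t :=
      inter_mem_nhdsWithin _ (Iio_mem_nhds (by linarith))
    exact mem_of_superset this fun s hs => ⟨hs.1, (mem_Iio.1 hs.2).le⟩
  · intro t ht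
    obtain ⟨C, hC⟩ := h'.2 (t + 1)
    exact hasDerivAt_integral_of_wt_bound (T := t + 1)
      (fun s hs => h.decays hs.1.le) (fun s hs => h'.1 s hs.1.le)
      (fun s hs => hC s ⟨hs.1.le, hs.2.le⟩) (fun s hs => hd s hs.1) ⟨ht, by linarith⟩

end UnifDecays

/-! ### The quotients by X² and their equations. -/

/-- If `F` has derivative `G` along all trajectories `x e^{4t}` with `x > 0`, then also along the
stationary trajectory at `0`. -/
lemma hasDerivAt_zero_of_trajectories {F G : ℝ → ℝ → ℝ}
    (hF : Continuous fun p : ℝ × ℝ => F p.1 p.2) (hG : Continuous fun p : ℝ × ℝ => G p.1 p.2)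
    (hd : ∀ t > 0, ∀ x > 0, HasDerivAt (fun s => F s (x * Real.exp (4 * s)))
      (G t (x * Real.exp (4 * t))) t) {t : ℝ} (ht : 0 < t) :
    HasDerivAt (fun s => F s 0) (G t 0) t := by
  have hGc : Continuous fun p : ℝ × ℝ => G p.2 (p.1 * Real.exp (4 * p.2)) :=
    hG.comp (by fun_prop : Continuous fun p : ℝ × ℝ => (p.2, p.1 * Real.exp (4 * p.2)))
  -- No differential equation is given at x = 0; the integrated identity along x e^{4t} passes to
  -- the limit x → 0⁺ by continuity.
  have h1 : ∀ s ≥ 0, F s 0 = F 0 0 + ∫ r in (0 : ℝ)..s, G r 0 := by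
    intro s hs
    have h2 : ∀ x > 0, ∫ r in (0 : ℝ)..s, G r (x * Real.exp (4 * r))
        = F s (x * Real.exp (4 * s)) - F 0 x := fun x hx => by
      have := intervalIntegral.integral_eq_sub_of_hasDerivAt_of_le hs
        (f := fun s => F s (x * Real.exp (4 * s)))
        (f' := fun r => G r (x * Real.exp (4 * r)))
        (hF.comp (by fun_prop : Continuous fun s : ℝ => (s, x * Real.exp (4 * s)))).continuousOn
        (fun r hr => hd r hr.1 x hx)
        ((hGc.comp (by fun_prop : Continuous fun r : ℝ => (x, r))).intervalIntegrable _ _)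
      simpa using this
    have h3 : Continuous fun x => ∫ r in (0 : ℝ)..s, G r (x * Real.exp (4 * r)) :=
      intervalIntegral.continuous_parametric_intervalIntegral_of_continuous' hGc _ _
    have h4 : Continuous fun x => F s (x * Real.exp (4 * s)) - F 0 x :=
      (hF.comp (by fun_prop : Continuous fun x : ℝ => (s, x * Real.exp (4 * s)))).sub
        (hF.comp (by fun_prop : Continuous fun x : ℝ => ((0 : ℝ), x)))
    have h5 := tendsto_nhds_unique (((h3.tendsto 0).mono_left nhdsWithin_le_nhds).congr'
      (by filter_upwards [self_mem_nhdsWithin] with x hx using h2 x hx))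
      ((h4.tendsto 0).mono_left (nhdsWithin_le_nhds (s := Ioi 0)))
    simp only [zero_mul] at h5
    linarith
  have hG0 : Continuous fun r => G r 0 :=
    hG.comp (by fun_prop : Continuous fun r : ℝ => (r, (0 : ℝ)))
  have h6 := (intervalIntegral.integral_hasDerivAt_right (hG0.intervalIntegrable 0 t)
    (hG0.stronglyMeasurableAtFilter _ _) hG0.continuousAt).const_add (F 0 0)
  refine h6.congr_of_eventuallyEq ?_
  filter_upwards [Ioi_mem_nhds ht] with s hs
  exact h1 s (mem_Ioi.1 hs).le

/-- The quotient `(f(t, X) - f(t, 0)) / X²` at the point `X = x e^{4t}`. -/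
def quot (f : ℝ → ℝ → ℝ) (t x : ℝ) : ℝ :=
  (f t (x * Real.exp (4 * t)) - f t 0) / (x * Real.exp (4 * t)) ^ 2

namespace IsFlow

variable {f g : ℝ → ℝ → ℝ} {m : ℝ → ℝ}

lemma hasDerivAt_fst_zero (h : IsFlow f g m) {t : ℝ} (ht : 0 < t) :
    HasDerivAt (fun s => f s 0) (-6 * f t 0 + g t 0) t :=
  hasDerivAt_zero_of_trajectories (G := fun t x => -6 * f t x + g t x) h.cont_fst
    ((h.cont_fst.const_mul _).add h.cont_snd) h.deriv_fst ht

lemma hasDerivAt_snd_zero (h : IsFlow f g m) {t : ℝ} (ht : 0 < t) :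
    HasDerivAt (fun s => g s 0) (-9 * g t 0 + 130 * (f t 0 - m t)) t := by
  have := hasDerivAt_zero_of_trajectories
    (G := fun t x => -9 * g t x + 130 * wt x * (f t x - m t)) h.cont_snd
    ((h.cont_snd.const_mul _).add (((continuous_wt.comp continuous_snd).const_mul 130).mul
      (h.cont_fst.sub (h.cont_mean.comp continuous_fst)))) h.deriv_snd ht
  simpa [wt] using this

lemma continuous_fst_zero (h : IsFlow f g m) : Continuous fun t => f t 0 :=
  h.cont_fst.comp (by fun_prop : Continuous fun t : ℝ => (t, (0 : ℝ)))

lemma continuous_snd_zero (h : IsFlow f g m) : Continuous fun t => g t 0 :=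
  h.cont_snd.comp (by fun_prop : Continuous fun t : ℝ => (t, (0 : ℝ)))

lemma hasDerivAt_traj_sq (x t : ℝ) : HasDerivAt (fun s => (x * Real.exp (4 * s)) ^ 2)
    (8 * (x * Real.exp (4 * t)) ^ 2) t := by
  have h1 : HasDerivAt (fun s : ℝ => x * Real.exp (4 * s)) (x * (Real.exp (4 * t) * 4)) t := by
    have : HasDerivAt (fun s : ℝ => 4 * s) 4 t := by simpa using (hasDerivAt_id t).const_mul 4
    exact this.exp.const_mul x
  refine (h1.fun_pow 2).congr_deriv ?_
  ring

/-- Dividing by X², which grows like e^{8t}, adds 8 to the damping: -6 becomes -14, and below -9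
becomes -17. -/
lemma hasDerivAt_quot_fst (h : IsFlow f g m) {t x : ℝ} (ht : 0 < t) (hx : 0 < x) :
    HasDerivAt (fun s => quot f s x) (-14 * quot f t x + quot g t x) t := by
  have hX : (x * Real.exp (4 * t)) ^ 2 ≠ 0 := by positivity
  refine (((h.deriv_fst t ht x hx).sub (h.hasDerivAt_fst_zero ht)).fun_div
    (hasDerivAt_traj_sq x t) hX).congr_deriv ?_
  unfold quot
  field_simp
  simp only [Pi.sub_apply]
  ring

/-- Since wt X - 1 = -X² wt X, the difference wt X (f - m) - (f₀ - m), with f₀ = f(t,0), equals X²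
wt X (quot f - (f₀ - m)): the gap enters only through the weight. -/
lemma hasDerivAt_quot_snd (h : IsFlow f g m) {t x : ℝ} (ht : 0 < t) (hx : 0 < x) :
    HasDerivAt (fun s => quot g s x) (-17 * quot g t x
      + 130 * wt (x * Real.exp (4 * t)) * (quot f t x - (f t 0 - m t))) t := by
  have hX : (x * Real.exp (4 * t)) ^ 2 ≠ 0 := by positivity
  refine (((h.deriv_snd t ht x hx).sub (h.hasDerivAt_snd_zero ht)).fun_div
    (hasDerivAt_traj_sq x t) hX).congr_deriv ?_
  have hw := sq_mul_wt (x * Real.exp (4 * t))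
  have hf : f t (x * Real.exp (4 * t)) - f t 0 = quot f t x * (x * Real.exp (4 * t)) ^ 2 :=
    (div_mul_cancel₀ _ hX).symm
  have hg : g t (x * Real.exp (4 * t)) - g t 0 = quot g t x * (x * Real.exp (4 * t)) ^ 2 :=
    (div_mul_cancel₀ _ hX).symm
  simp only [Pi.sub_apply]
  rw [div_eq_iff (by positivity)]
  generalize x * Real.exp (4 * t) = X at *
  linear_combination (-17 * X ^ 2) * hg + 130 * wt X * X ^ 2 * hf
    + 130 * (f t 0 - m t) * X ^ 2 * hw

lemma continuousOn_quot {f : ℝ → ℝ → ℝ} (hf : Continuous fun p : ℝ × ℝ => f p.1 p.2) (t : ℝ) :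
    ContinuousOn (quot f t) (Ioi 0) := by
  have h1 : Continuous fun x => f t (x * Real.exp (4 * t)) - f t 0 :=
    (hf.comp (by fun_prop : Continuous fun x : ℝ => (t, x * Real.exp (4 * t)))).sub
      continuous_const
  refine h1.continuousOn.div (by fun_prop) (fun x hx => ?_)
  have := mem_Ioi.1 hx
  positivity

lemma continuous_quot_time {f : ℝ → ℝ → ℝ} (hf : Continuous fun p : ℝ × ℝ => f p.1 p.2)
    {x : ℝ} (hx : 0 < x) : Continuous fun t => quot f t x := by
  have h1 : Continuous fun t => f t (x * Real.exp (4 * t)) - f t 0 :=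
    (hf.comp (by fun_prop : Continuous fun t : ℝ => (t, x * Real.exp (4 * t)))).sub
      (hf.comp (by fun_prop : Continuous fun t : ℝ => (t, (0 : ℝ))))
  exact h1.div (by fun_prop) (fun t => by positivity)

lemma unifBdd_wt : UnifBdd (fun t x => wt (x * Real.exp (4 * t))) :=
  ⟨fun t _ => (continuous_wt.comp (by fun_prop)).continuousOn, fun _ => ⟨1, fun t _ x _ => by
    rw [abs_of_pos (wt_pos _)]; exact wt_le_one _⟩⟩

lemma unifDecays_wt : UnifDecays (fun t x => wt (x * Real.exp (4 * t))) :=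
  ⟨fun t _ => (continuous_wt.comp (by fun_prop)).continuousOn, fun _ => ⟨1, fun t ht x hx => by
    rw [abs_of_pos (wt_pos _), one_mul]
    unfold wt
    have h1 : 1 ≤ Real.exp (4 * t) := Real.one_le_exp (by linarith [ht.1])
    have h2 : x ≤ x * Real.exp (4 * t) := by nlinarith
    gcongr⟩⟩

lemma unifBdd_of_continuous {s : ℝ → ℝ} (hs : Continuous s) : UnifBdd (fun t _ => s t) :=
  ⟨fun _ _ => continuousOn_const, fun T => by
    obtain ⟨C, hC⟩ := (isCompact_Icc (a := (0 : ℝ)) (b := T)).exists_bound_of_continuousOn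
      hs.continuousOn
    exact ⟨C, fun t ht _ _ => hC t ht⟩⟩

/-- Grönwall at fixed x for quot f² + quot g² + 1. The rate is crude and only has to be independent
of x; the summand 1 absorbs the forcing by f(t,0) - m(t), which is bounded by S on [0, T]. -/
lemma exists_quot_le (h : IsFlow f g m) {K : ℝ} (hf : ∀ x > 0, |f 0 x - f 0 0| ≤ K * x ^ 2)
    (hg : ∀ x > 0, |g 0 x - g 0 0| ≤ K * x ^ 2) (T : ℝ) :
    ∃ C, ∀ t ∈ Icc 0 T, ∀ x > 0, |quot f t x| ≤ C ∧ |quot g t x| ≤ C := by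
  obtain ⟨S, hS⟩ := (isCompact_Icc (a := (0 : ℝ)) (b := T)).exists_bound_of_continuousOn
    (h.continuous_fst_zero.sub h.cont_mean).continuousOn
  set L := 300 + 130 * S ^ 2 with hL
  refine ⟨Real.exp (L * T) * (2 * K ^ 2 + 1), fun t ht x hx => ?_⟩
  have hT : 0 ≤ T := ht.1.trans ht.2
  have h0 : ∀ {f : ℝ → ℝ → ℝ}, (∀ x > 0, |f 0 x - f 0 0| ≤ K * x ^ 2) →
      quot f 0 x ^ 2 ≤ K ^ 2 := fun {f} hf => by
    have : |quot f 0 x| ≤ K := by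
      unfold quot
      rw [abs_div, abs_of_pos (by positivity : 0 < (x * Real.exp (4 * 0)) ^ 2),
        div_le_iff₀ (by positivity)]
      simpa using hf x hx
    exact sq_le_sq' (abs_le.1 this).1 (abs_le.1 this).2
  have hanti : AntitoneOn (fun s => Real.exp (-L * s) * (quot f s x ^ 2 + quot g s x ^ 2 + 1))
      (Icc 0 T) := by
    have hd : ∀ s ∈ Ioo 0 T, HasDerivAt
        (fun s => Real.exp (-L * s) * (quot f s x ^ 2 + quot g s x ^ 2 + 1))
        (Real.exp (-L * s) * (2 * quot f s x * (-14 * quot f s x + quot g s x)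
          + 2 * quot g s x * (-17 * quot g s x + 130 * wt (x * Real.exp (4 * s)) *
            (quot f s x - (f s 0 - m s))) - L * (quot f s x ^ 2 + quot g s x ^ 2 + 1))) s := by
      intro s hs
      have h1 : HasDerivAt (fun s : ℝ => -L * s) (-L) s := by
        simpa using (hasDerivAt_id s).const_mul (-L)
      refine (h1.exp.mul ((((h.hasDerivAt_quot_fst hs.1 hx).fun_pow 2).add
        ((h.hasDerivAt_quot_snd hs.1 hx).fun_pow 2)).add_const 1)).congr_deriv ?_
      simp only [Pi.add_apply]
      push_cast
      ring
    have cf := continuous_quot_time h.cont_fst hx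
    have cg := continuous_quot_time h.cont_snd hx
    refine antitoneOn_of_deriv_nonpos (convex_Icc 0 T) (by fun_prop) ?_ ?_
    · rw [interior_Icc]
      exact fun s hs => (hd s hs).differentiableAt.differentiableWithinAt
    · rw [interior_Icc]
      intro s hs
      rw [(hd s hs).deriv]
      refine mul_nonpos_of_nonneg_of_nonpos (Real.exp_pos _).le ?_
      have hw := wt_pos (x * Real.exp (4 * s))
      have hw1 := wt_le_one (x * Real.exp (4 * s))
      have hs2 := hS s ⟨hs.1.le, hs.2.le⟩
      rw [Real.norm_eq_abs] at hs2
      simp only [Pi.sub_apply] at hs2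
      have hsig : (f s 0 - m s) ^ 2 ≤ S ^ 2 := sq_le_sq' (abs_le.1 hs2).1 (abs_le.1 hs2).2
      generalize wt (x * Real.exp (4 * s)) = w at *
      generalize f s 0 - m s = σ at *
      generalize quot f s x = a at *
      generalize quot g s x = b at *
      have e1 : w * (2 * a * b) ≤ a ^ 2 + b ^ 2 := by
        have : 0 ≤ (1 - w) * (a ^ 2 + b ^ 2) + w * (a - b) ^ 2 := by
          have := sub_nonneg.2 hw1
          positivity
        nlinarith
      have e2 : -(w * (2 * σ * b)) ≤ S ^ 2 + b ^ 2 := by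
        have : 0 ≤ (1 - w) * (σ ^ 2 + b ^ 2) + w * (σ + b) ^ 2 := by
          have := sub_nonneg.2 hw1
          positivity
        nlinarith
      have e3 : 2 * a * b ≤ a ^ 2 + b ^ 2 := two_mul_le_add_sq a b
      have e4 : 0 ≤ S ^ 2 * (a ^ 2 + b ^ 2) := by positivity
      rw [hL]
      nlinarith [sq_nonneg a, sq_nonneg b]
  have h1 := hanti ⟨le_rfl, hT⟩ ht ht.1
  simp only [mul_zero, Real.exp_zero, one_mul] at h1
  have h2 : quot f t x ^ 2 + quot g t x ^ 2 + 1 ≤ Real.exp (L * T) * (2 * K ^ 2 + 1) := by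
    have e : quot f t x ^ 2 + quot g t x ^ 2 + 1 = Real.exp (L * t) *
        (Real.exp (-L * t) * (quot f t x ^ 2 + quot g t x ^ 2 + 1)) := by
      rw [← mul_assoc, ← Real.exp_add]; simp
    rw [e]
    have hL0 : 0 ≤ L := by positivity
    have := ht.2
    have h3 := h0 hf
    have h4 := h0 hg
    refine mul_le_mul (Real.exp_le_exp.2 (by gcongr)) (by linarith) (by positivity)
      (by positivity)
  constructor
  · rw [abs_le]; constructor <;> nlinarith [sq_nonneg (quot f t x - 1), sq_nonneg (quot f t x + 1),
      sq_nonneg (quot g t x)]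
  · rw [abs_le]; constructor <;> nlinarith [sq_nonneg (quot g t x - 1), sq_nonneg (quot g t x + 1),
      sq_nonneg (quot f t x)]

/-- Near 0 the quotients are bounded by `exists_quot_le`; for large x the bound on f and g gives
2M/x², as x ≤ x e^{4t}. -/
lemma unifDecays_quot (h : IsFlow f g m) {K : ℝ} (hf : ∀ x > 0, |f 0 x - f 0 0| ≤ K * x ^ 2)
    (hg : ∀ x > 0, |g 0 x - g 0 0| ≤ K * x ^ 2) :
    UnifDecays (quot f) ∧ UnifDecays (quot g) := by
  have key : ∀ T, ∃ C, ∀ t ∈ Icc 0 T, ∀ x > 0, |quot f t x| ≤ C * wt x ∧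
      |quot g t x| ≤ C * wt x := by
    intro T
    obtain ⟨C, hC⟩ := h.exists_quot_le hf hg T
    obtain ⟨M, hM⟩ := h.bounded T
    have aux : ∀ {f : ℝ → ℝ → ℝ} {t x : ℝ}, t ∈ Icc 0 T → 0 < x → (∀ x, |f t x| ≤ M) →
        |quot f t x| ≤ C → |quot f t x| ≤ (C + 2 * M) * wt x := fun {f t x} ht hx hM hC => by
      have h1 : |quot f t x| * x ^ 2 ≤ 2 * M := by
        have h2 : |quot f t x| * (x * Real.exp (4 * t)) ^ 2 ≤ 2 * M := by
          unfold quot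
          rw [abs_div, abs_of_pos (by positivity : 0 < (x * Real.exp (4 * t)) ^ 2),
            div_mul_cancel₀ _ (by positivity)]
          calc _ ≤ |f t (x * Real.exp (4 * t))| + |f t 0| := abs_sub _ _
            _ ≤ _ := by linarith [hM (x * Real.exp (4 * t)), hM 0]
        have h3 : 1 ≤ Real.exp (4 * t) := Real.one_le_exp (by linarith [ht.1])
        have h4 : x ≤ x * Real.exp (4 * t) := by nlinarith
        refine le_trans ?_ h2
        gcongr
      unfold wt
      rw [← div_eq_mul_inv, le_div_iff₀ (by positivity)]
      nlinarith
    exact ⟨C + 2 * M, fun t ht x hx =>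
      ⟨aux ht hx (fun x => (hM t ht x).1) (hC t ht x hx).1,
        aux ht hx (fun x => (hM t ht x).2) (hC t ht x hx).2⟩⟩
  refine ⟨⟨fun t _ => continuousOn_quot h.cont_fst t, fun T => ?_⟩,
    ⟨fun t _ => continuousOn_quot h.cont_snd t, fun T => ?_⟩⟩
  · obtain ⟨C, hC⟩ := key T
    exact ⟨C, fun t ht x hx => (hC t ht x hx).1⟩
  · obtain ⟨C, hC⟩ := key T
    exact ⟨C, fun t ht x hx => (hC t ht x hx).2⟩

end IsFlow

/-! ### The closed system for the moments of the quotients. -/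

lemma integral_comp_traj (φ : ℝ → ℝ) (t : ℝ) :
    ∫ x in Ioi 0, φ (x * Real.exp (4 * t)) = Real.exp (-4 * t) * ∫ x in Ioi 0, φ x := by
  rw [integral_comp_mul_right_Ioi φ 0 (Real.exp_pos _), zero_mul, ← Real.exp_neg, smul_eq_mul]
  congr 2
  ring

lemma integral_wt_traj (t : ℝ) :
    ∫ x in Ioi 0, wt (x * Real.exp (4 * t)) = Real.exp (-4 * t) * (Real.pi / 2) := by
  rw [integral_comp_traj, integral_wt]

lemma integral_wt_sq_traj (t : ℝ) :
    ∫ x in Ioi 0, wt (x * Real.exp (4 * t)) ^ 2 = Real.exp (-4 * t) * (Real.pi / 4) := by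
  rw [integral_comp_traj (fun x => wt x ^ 2), integral_wt_pow 1]
  simp only [wtMoment]
  norm_num
  ring

/-- The factor 1 - wt X = X² wt X cancels the denominator, which leaves the mean of f - f(t,0). This
is the only place where m enters as an average. -/
lemma IsFlow.integral_one_sub_wt_mul_quot {f g : ℝ → ℝ → ℝ} {m : ℝ → ℝ} (h : IsFlow f g m)
    {t : ℝ} (ht : 0 ≤ t) :
    ∫ x in Ioi 0, (1 - wt (x * Real.exp (4 * t))) * quot f t x
      = - (Real.exp (-4 * t) * (Real.pi / 2 * (f t 0 - m t))) := by
  have h1 : ∫ x in Ioi 0, (wt x * f t x - f t 0 * wt x) = Real.pi / 2 * (m t - f t 0) := by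
    rw [integral_sub (h.decays_wt_mul_fst ht).integrableOn (Decays.wt.const_mul _).integrableOn,
      integral_const_mul, integral_wt, h.mean_eq t ht]
    ring
  have h2 : ∀ x ∈ Ioi (0 : ℝ), (1 - wt (x * Real.exp (4 * t))) * quot f t x
      = (fun X => wt X * f t X - f t 0 * wt X) (x * Real.exp (4 * t)) := fun x hx => by
    have := mem_Ioi.1 hx
    rw [← sq_mul_wt, quot]
    field_simp
  rw [setIntegral_congr_fun measurableSet_Ioi h2,
    integral_comp_traj (fun X => wt X * f t X - f t 0 * wt X), h1]
  ring

namespace IsFlow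

variable {f g : ℝ → ℝ → ℝ} {m : ℝ → ℝ} {K : ℝ}

lemma unifDecays_deriv_quot_snd (h : IsFlow f g m) (hf : ∀ x > 0, |f 0 x - f 0 0| ≤ K * x ^ 2)
    (hg : ∀ x > 0, |g 0 x - g 0 0| ≤ K * x ^ 2) :
    UnifDecays fun t x => -17 * quot g t x
      + 130 * wt (x * Real.exp (4 * t)) * (quot f t x - (f t 0 - m t)) := by
  obtain ⟨uf, ug⟩ := h.unifDecays_quot hf hg
  have us := unifDecays_wt.bdd_mul
    (unifBdd_of_continuous (h.continuous_fst_zero.sub h.cont_mean))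
  exact ((ug.const_mul (-17)).add (((uf.bdd_mul unifBdd_wt).const_mul 130).add
    (us.const_mul (-130)))).congr fun t x => by simp only [Pi.sub_apply]; ring

lemma hasDerivAt_integral_quot_fst (h : IsFlow f g m)
    (hf : ∀ x > 0, |f 0 x - f 0 0| ≤ K * x ^ 2) (hg : ∀ x > 0, |g 0 x - g 0 0| ≤ K * x ^ 2) :
    ContinuousOn (fun t => ∫ x in Ioi 0, quot f t x) (Ici 0) ∧
      ∀ t > 0, HasDerivAt (fun t => ∫ x in Ioi 0, quot f t x)
        (-14 * (∫ x in Ioi 0, quot f t x) + ∫ x in Ioi 0, quot g t x) t := by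
  obtain ⟨uf, ug⟩ := h.unifDecays_quot hf hg
  obtain ⟨h1, h2⟩ := uf.continuousOn_and_hasDerivAt_integral ((uf.const_mul (-14)).add ug)
    (fun x hx => (continuous_quot_time h.cont_fst hx).continuousOn)
    (fun t ht x hx => h.hasDerivAt_quot_fst ht hx)
  refine ⟨h1, fun t ht => (h2 t ht).congr_deriv ?_⟩
  rw [integral_add ((uf.decays ht.le).const_mul _).integrableOn (ug.decays ht.le).integrableOn,
    integral_const_mul]

lemma decays_wt_traj {t : ℝ} (ht : 0 ≤ t) : Decays fun x => wt (x * Real.exp (4 * t)) :=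
  unifDecays_wt.decays ht

lemma integral_wt_mul_quot (h : IsFlow f g m) (hf : ∀ x > 0, |f 0 x - f 0 0| ≤ K * x ^ 2)
    (hg : ∀ x > 0, |g 0 x - g 0 0| ≤ K * x ^ 2) {t : ℝ} (ht : 0 ≤ t) :
    ∫ x in Ioi 0, wt (x * Real.exp (4 * t)) * quot f t x
      = (∫ x in Ioi 0, quot f t x) + Real.exp (-4 * t) * (Real.pi / 2 * (f t 0 - m t)) := by
  obtain ⟨uf, ug⟩ := h.unifDecays_quot hf hg
  have h1 := h.integral_one_sub_wt_mul_quot ht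
  simp only [sub_mul, one_mul] at h1
  rw [integral_sub (uf.decays ht).integrableOn
    ((decays_wt_traj ht).mul (uf.decays ht)).integrableOn] at h1
  linarith

/-- By `integral_wt_mul_quot` the weighted integral of quot f equals its plain integral plus the gap
term, and that term cancels the forcing. Neither weight nor gap survives, so the moment system is
closed. -/
lemma hasDerivAt_integral_quot_snd (h : IsFlow f g m)
    (hf : ∀ x > 0, |f 0 x - f 0 0| ≤ K * x ^ 2) (hg : ∀ x > 0, |g 0 x - g 0 0| ≤ K * x ^ 2) :
    ContinuousOn (fun t => ∫ x in Ioi 0, quot g t x) (Ici 0) ∧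
      ∀ t > 0, HasDerivAt (fun t => ∫ x in Ioi 0, quot g t x)
        (-17 * (∫ x in Ioi 0, quot g t x) + 130 * ∫ x in Ioi 0, quot f t x) t := by
  obtain ⟨uf, ug⟩ := h.unifDecays_quot hf hg
  obtain ⟨h1, h2⟩ := ug.continuousOn_and_hasDerivAt_integral (h.unifDecays_deriv_quot_snd hf hg)
    (fun x hx => (continuous_quot_time h.cont_snd hx).continuousOn)
    (fun t ht x hx => h.hasDerivAt_quot_snd ht hx)
  refine ⟨h1, fun t ht => (h2 t ht).congr_deriv ?_⟩
  have e : ∀ x, -17 * quot g t x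
      + 130 * wt (x * Real.exp (4 * t)) * (quot f t x - (f t 0 - m t))
      = (-17 * quot g t x + 130 * (wt (x * Real.exp (4 * t)) * quot f t x))
        - (130 * (f t 0 - m t)) * wt (x * Real.exp (4 * t)) := fun x => by ring
  have dw := decays_wt_traj ht.le
  have df := uf.decays ht.le
  have dg := ug.decays ht.le
  simp_rw [e]
  rw [integral_sub ((dg.const_mul _).add ((dw.mul df).const_mul _)).integrableOn
    (dw.const_mul _).integrableOn, integral_add (dg.const_mul _).integrableOn
    ((dw.mul df).const_mul _).integrableOn, integral_const_mul, integral_const_mul,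
    integral_const_mul, h.integral_wt_mul_quot hf hg ht.le, integral_wt_traj]
  ring

lemma hasDerivAt_exp_mul (c t : ℝ) :
    HasDerivAt (fun s => Real.exp (c * s)) (c * Real.exp (c * t)) t := by
  have h1 : HasDerivAt (fun s : ℝ => c * s) c t := by simpa using (hasDerivAt_id t).const_mul c
  exact h1.exp.congr_deriv (mul_comm _ _)

/-- The moments `∫ quot f`, `∫ quot g` solve a closed linear system, solved here on its
stable eigenspace. -/
lemma integral_quot_eq (h : IsFlow f g m)
    (hf : ∀ x > 0, |f 0 x - f 0 0| ≤ K * x ^ 2) (hg : ∀ x > 0, |g 0 x - g 0 0| ≤ K * x ^ 2)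
    (h0 : ∫ x in Ioi 0, quot g 0 x = -13 * ∫ x in Ioi 0, quot f 0 x) {t : ℝ} (ht : 0 ≤ t) :
    ∫ x in Ioi 0, quot f t x = Real.exp (-27 * t) * ∫ x in Ioi 0, quot f 0 x := by
  obtain ⟨cP, dP⟩ := h.hasDerivAt_integral_quot_fst hf hg
  obtain ⟨cQ, dQ⟩ := h.hasDerivAt_integral_quot_snd hf hg
  -- 13P + Q and -10P + Q are the left eigenvectors of the moment matrix, with eigenvalues -4 and
  -- -27; the hypothesis `h0` kills the first.
  have e1 := eq_of_hasDerivAt_zero (φ := fun t => Real.exp (4 * t) *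
    (13 * (∫ x in Ioi 0, quot f t x) + ∫ x in Ioi 0, quot g t x)) (by fun_prop)
    (fun t ht => ((hasDerivAt_exp_mul 4 t).fun_mul
      (((dP t ht).const_mul 13).fun_add (dQ t ht))).congr_deriv (by ring)) ht
  have e2 := eq_of_hasDerivAt_zero (φ := fun t => Real.exp (27 * t) *
    (-10 * (∫ x in Ioi 0, quot f t x) + ∫ x in Ioi 0, quot g t x)) (by fun_prop)
    (fun t ht => ((hasDerivAt_exp_mul 27 t).fun_mul
      (((dP t ht).const_mul (-10)).fun_add (dQ t ht))).congr_deriv (by ring)) ht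
  simp only [mul_zero, Real.exp_zero, one_mul, h0] at e1 e2
  have e3 : 13 * (∫ x in Ioi 0, quot f t x) + ∫ x in Ioi 0, quot g t x = 0 := by
    have : Real.exp (4 * t) * (13 * (∫ x in Ioi 0, quot f t x) + ∫ x in Ioi 0, quot g t x) = 0 := by
      rw [e1]; ring
    exact (mul_eq_zero.1 this).resolve_left (Real.exp_pos _).ne'
  have e4 : Real.exp (-27 * t) * Real.exp (27 * t) = 1 := by rw [← Real.exp_add]; simp
  linear_combination (-1 / 23 * Real.exp (-27 * t)) * e2
    + (-(∫ x in Ioi 0, quot f t x)) * e4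
    + (1 / 23 * (Real.exp (-27 * t) * Real.exp (27 * t))) * e3

/-! ### Energy decay and the bound on the gap. -/

/-- The weighted energy of the quotients. -/
def energy (f g : ℝ → ℝ → ℝ) (t : ℝ) : ℝ :=
  ∫ x in Ioi 0, (quot f t x ^ 2 + 1 / 130 * quot g t x ^ 2)

/-- The energy inequality. -/
lemma exists_hasDerivAt_energy (h : IsFlow f g m)
    (hf : ∀ x > 0, |f 0 x - f 0 0| ≤ K * x ^ 2) (hg : ∀ x > 0, |g 0 x - g 0 0| ≤ K * x ^ 2) :
    ContinuousOn (energy f g) (Ici 0) ∧ ∀ t > 0, ∀ η > 0, ∃ d, HasDerivAt (energy f g) d t ∧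
      d ≤ -8 * energy f g t + |2 / Real.pi * Real.exp (4 * t) * ∫ x in Ioi 0, quot f t x| *
        (η * (130 * energy f g t) + Real.exp (-4 * t) * (Real.pi / 4) / η) := by
  obtain ⟨uf, ug⟩ := h.unifDecays_quot hf hg
  have uE : UnifDecays fun t x => quot f t x ^ 2 + 1 / 130 * quot g t x ^ 2 :=
    ((uf.mul uf).add ((ug.mul ug).const_mul (1 / 130))).congr fun t x => by ring
  have ug' := h.unifDecays_deriv_quot_snd hf hg
  have uf' : UnifDecays fun t x => -14 * quot f t x + quot g t x := (uf.const_mul (-14)).add ug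
  have uE' := ((uf.mul uf').const_mul 2).add ((ug.mul ug').const_mul (2 / 130))
  obtain ⟨h1, h2⟩ := uE.continuousOn_and_hasDerivAt_integral uE'
    (fun x hx => (((continuous_quot_time h.cont_fst hx).pow 2).add
      (((continuous_quot_time h.cont_snd hx).pow 2).const_mul (1 / 130))).continuousOn)
    (fun t ht x hx => (((h.hasDerivAt_quot_fst ht hx).fun_pow 2).fun_add
      (((h.hasDerivAt_quot_snd ht hx).fun_pow 2).const_mul (1 / 130))).congr_deriv
        (by push_cast; ring))
  refine ⟨h1, fun t ht η hη => ⟨_, h2 t ht, ?_⟩⟩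
  have df := uf.decays ht.le
  have dg := ug.decays ht.le
  have dw := decays_wt_traj ht.le
  have hK := h.integral_wt_mul_quot hf hg ht.le
  have hE : energy f g t = (∫ x in Ioi 0, quot f t x ^ 2)
      + 1 / 130 * ∫ x in Ioi 0, quot g t x ^ 2 := by
    rw [energy, integral_add df.sq.integrableOn (dg.sq.const_mul _).integrableOn,
      integral_const_mul]
  set P := ∫ x in Ioi 0, quot f t x with hP
  set τ := 2 / Real.pi * Real.exp (4 * t) * P with hτ
  set σ := f t 0 - m t with hσ
  set A := ∫ x in Ioi 0, quot f t x ^ 2 with hA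
  set B := ∫ x in Ioi 0, quot g t x ^ 2 with hB
  have hexp : Real.exp (4 * t) * Real.exp (-4 * t) = 1 := by rw [← Real.exp_add]; simp
  have hpi := Real.pi_pos
  -- the mean of `quot f` with respect to `wt`
  have hc : (∫ x in Ioi 0, wt (x * Real.exp (4 * t)) * quot f t x)
      = (σ + τ) * (Real.exp (-4 * t) * (Real.pi / 2)) := by
    rw [hK, hτ]
    generalize Real.exp (-4 * t) = e at *
    generalize Real.exp (4 * t) = E at *
    field_simp
    linear_combination (-2 * P) * hexp
  have d0 := uE'.decays ht.le
  rw [← hσ] at d0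
  -- Here c = σ + τ is exactly the mean of quot f for the measure `wt` (X) dx. The terms in c
  -- produced by 10 wt (quot f - c)² then integrate to -10 c² ∫ wt ≤ 0, so only the fast-decaying τ
  -- acts as forcing.
  have hσc : σ = σ + τ - τ := by ring
  rw [hσc] at d0 ⊢
  generalize σ + τ = c at hc d0 ⊢
  have hb : ∀ x, 2 * (quot f t x * (-14 * quot f t x + quot g t x)) +
      2 / 130 * (quot g t x * (-17 * quot g t x
        + 130 * wt (x * Real.exp (4 * t)) * (quot f t x - (c - τ))))
      ≤ (((((-8 * quot f t x ^ 2 + -8 / 130 * quot g t x ^ 2)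
        + -20 * c * (wt (x * Real.exp (4 * t)) * quot f t x))
        + 10 * c ^ 2 * wt (x * Real.exp (4 * t)))
        + |τ| * η * quot g t x ^ 2) + |τ| / η * wt (x * Real.exp (4 * t)) ^ 2) := fun x => by
    have hw := wt_pos (x * Real.exp (4 * t))
    have hw1 := wt_le_one (x * Real.exp (4 * t))
    generalize wt (x * Real.exp (4 * t)) = w at *
    generalize quot f t x = a at *
    generalize quot g t x = b at *
    -- The Young weights 10 and 1/10 balance both components at rate 8: -28 + 10 + 10 = -8 for a²,
    -- and (-34 + 13 + 13)/130 = -8/130 for b².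
    have e1 : 2 * (a * b) ≤ 10 * a ^ 2 + 1 / 10 * b ^ 2 := by nlinarith [sq_nonneg (10 * a - b)]
    have e2 : 2 * (b * (w * (a - c))) ≤ 1 / 10 * b ^ 2 + 10 * (w * (a - c) ^ 2) := by
      have h1 : 2 * (b * (w * (a - c))) ≤ 1 / 10 * b ^ 2 + 10 * (w * (a - c)) ^ 2 := by
        nlinarith [sq_nonneg (10 * (w * (a - c)) - b)]
      have h2 : (w * (a - c)) ^ 2 ≤ w * (a - c) ^ 2 := by
        rw [mul_pow]
        exact mul_le_mul_of_nonneg_right (by nlinarith) (sq_nonneg _)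
      linarith
    have e3 : 2 * (τ * (b * w)) ≤ |τ| * η * b ^ 2 + |τ| / η * w ^ 2 := by
      have h1 : 2 * |b * w| ≤ η * b ^ 2 + w ^ 2 / η := by
        have : 0 ≤ (η * |b| - w) ^ 2 / η := by positivity
        have h3 : (η * |b| - w) ^ 2 / η = η * b ^ 2 + w ^ 2 / η - 2 * (|b| * w) := by
          rw [← sq_abs b]; field_simp; ring
        rw [abs_mul, abs_of_pos hw]
        linarith
      calc 2 * (τ * (b * w)) ≤ |τ| * (2 * |b * w|) := by
            have := le_abs_self (τ * (b * w))
            rw [abs_mul] at this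
            linarith
        _ ≤ |τ| * (η * b ^ 2 + w ^ 2 / η) := by gcongr
        _ = _ := by ring
    have e4 : w * a ^ 2 ≤ a ^ 2 := by nlinarith [sq_nonneg a]
    linarith
  have d1 := (df.sq.const_mul (-8)).add (dg.sq.const_mul (-8 / 130))
  have d2 := d1.add ((dw.mul df).const_mul (-20 * c))
  have d3 := d2.add (dw.const_mul (10 * c ^ 2))
  have d4 := d3.add (dg.sq.const_mul (|τ| * η))
  have d5 := d4.add (dw.sq.const_mul (|τ| / η))
  refine (integral_mono d0.integrableOn d5.integrableOn hb).trans ?_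
  rw [integral_add d4.integrableOn (dw.sq.const_mul _).integrableOn,
    integral_add d3.integrableOn (dg.sq.const_mul _).integrableOn,
    integral_add d2.integrableOn (dw.const_mul _).integrableOn,
    integral_add d1.integrableOn ((dw.mul df).const_mul _).integrableOn,
    integral_add (df.sq.const_mul _).integrableOn (dg.sq.const_mul _).integrableOn]
  simp only [integral_const_mul]
  rw [hc, integral_wt_traj, integral_wt_sq_traj, hE]
  have hA0 : 0 ≤ A := integral_nonneg fun x => sq_nonneg _
  have hp : 0 ≤ c ^ 2 * (Real.exp (-4 * t) * Real.pi) := by positivity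
  have hq : 0 ≤ |τ| * η * A := by positivity
  have e : |τ| * (η * (130 * (A + 1 / 130 * B)) + Real.exp (-4 * t) * (Real.pi / 4) / η)
      = 130 * (|τ| * η * A) + |τ| * η * B
        + |τ| / η * (Real.exp (-4 * t) * (Real.pi / 4)) := by ring
  rw [e]
  linarith

end IsFlow

namespace IsFlow

variable {f g : ℝ → ℝ → ℝ} {m : ℝ → ℝ} {K : ℝ}

lemma energy_nonneg (t : ℝ) : 0 ≤ energy f g t :=
  integral_nonneg fun x => by positivity

lemma energy_decay (h : IsFlow f g m)
    (hf : ∀ x > 0, |f 0 x - f 0 0| ≤ K * x ^ 2) (hg : ∀ x > 0, |g 0 x - g 0 0| ≤ K * x ^ 2)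
    (h0 : ∫ x in Ioi 0, quot g 0 x = -13 * ∫ x in Ioi 0, quot f 0 x)
    (hP : |∫ x in Ioi 0, quot f 0 x| ≤ 13 / 5) (hE : energy f g 0 ≤ 25) {t : ℝ} (ht : 0 ≤ t) :
    Real.exp (8 * t) * energy f g t ≤ 34.7 := by
  obtain ⟨hc, hd⟩ := h.exists_hasDerivAt_energy hf hg
  have hd' : ∀ t > 0, ∃ d, HasDerivAt (energy f g) d t ∧
      d ≤ -8 * energy f g t + 3.4 * Real.exp (-29 * t) *
        (Real.exp (8 * t) * energy f g t + 24.8) := fun t ht => by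
    -- τ decays like e^{-23t}. With η proportional to e^{2t} both error terms are multiples of
    -- e^{-29t}, one of them times e^{8t} E, so Y = e^{8t} E + 24.8 satisfies Y' ≤ 3.4 e^{-21t} Y.
    obtain ⟨d, h1, h2⟩ := hd t ht (Real.exp (2 * t) / 64) (by positivity)
    refine ⟨d, h1, h2.trans ?_⟩
    rw [h.integral_quot_eq hf hg h0 ht.le, abs_mul (2 / Real.pi * Real.exp (4 * t)),
      abs_mul (Real.exp (-27 * t)), abs_of_pos (Real.exp_pos (-27 * t)), abs_of_pos
      (by positivity : 0 < 2 / Real.pi * Real.exp (4 * t))]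
    set p := |∫ x in Ioi 0, quot f 0 x|
    have hp : 0 ≤ p := abs_nonneg _
    have hEn := energy_nonneg (f := f) (g := g) t
    have hpi := Real.pi_gt_d2
    have e1 : 2 / Real.pi * Real.exp (4 * t) * (Real.exp (-27 * t) * p) *
        (Real.exp (2 * t) / 64 * (130 * energy f g t)
          + Real.exp (-4 * t) * (Real.pi / 4) / (Real.exp (2 * t) / 64))
        = (2 / Real.pi * p * (130 / 64)) * (Real.exp (-21 * t) * energy f g t)
          + 32 * p * Real.exp (-29 * t) := by
      have e2 : Real.exp (4 * t) * Real.exp (-27 * t) * Real.exp (2 * t) = Real.exp (-21 * t) := by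
        rw [← Real.exp_add, ← Real.exp_add]; congr 1; ring
      have e3 : Real.exp (4 * t) * Real.exp (-27 * t) * Real.exp (-4 * t) / Real.exp (2 * t)
          = Real.exp (-29 * t) := by
        rw [← Real.exp_add, ← Real.exp_add, ← Real.exp_sub]; congr 1; ring
      rw [← e2, ← e3]
      have := Real.pi_pos
      field_simp
      ring
    have e4 : Real.exp (-29 * t) * (Real.exp (8 * t) * energy f g t)
        = Real.exp (-21 * t) * energy f g t := by
      rw [← mul_assoc, ← Real.exp_add]; congr 2; ring
    have e5 : 2 / Real.pi * p * (130 / 64) ≤ 3.4 := by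
      have hpos := Real.pi_pos
      have : 2 / Real.pi * p * (130 / 64) = (65 / 16 * p) / Real.pi := by field_simp; ring
      rw [this, div_le_iff₀ hpos]
      norm_num at hpi ⊢
      linarith
    have e6 : 0 ≤ Real.exp (-21 * t) * energy f g t := by positivity
    have e7 := Real.exp_pos (-29 * t)
    rw [e1, mul_add, mul_assoc 3.4, e4]
    linarith [mul_le_mul_of_nonneg_right e5 e6, mul_le_mul_of_nonneg_right hP e7.le]
  choose! d hd1 hd2 using hd'
  -- Integrating factor for Y' ≤ 3.4 e^{-21t} Y. As u ≥ -3.4/21 for t ≥ 0, it follows that Y ≤ 49.8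
  -- / (1 - 3.4/21), and subtracting 24.8 leaves less than 34.7.
  set u : ℝ → ℝ := fun t => 3.4 / 21 * (Real.exp (-21 * t) - 1) with hu
  have hud : ∀ t, HasDerivAt u (-3.4 * Real.exp (-21 * t)) t := fun t =>
    (((hasDerivAt_exp_mul (-21) t).sub_const 1).const_mul (3.4 / 21)).congr_deriv (by ring)
  have hanti := antitoneOn_Ici_of_hasDerivAt
    (φ := fun t => Real.exp (u t) * (Real.exp (8 * t) * energy f g t + 24.8))
    (φ' := fun t => Real.exp (u t) * (Real.exp (8 * t) * (d t + 8 * energy f g t)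
      - 3.4 * Real.exp (-21 * t) * (Real.exp (8 * t) * energy f g t + 24.8)))
    (by fun_prop)
    (fun t ht => ((hud t).exp.fun_mul (((hasDerivAt_exp_mul 8 t).fun_mul
      (hd1 t ht)).add_const 24.8)).congr_deriv (by ring))
    (fun t ht => by
      refine mul_nonpos_of_nonneg_of_nonpos (Real.exp_pos _).le ?_
      have e1 := mul_le_mul_of_nonneg_left (hd2 t ht) (Real.exp_pos (8 * t)).le
      have e2 : Real.exp (8 * t) * Real.exp (-29 * t) = Real.exp (-21 * t) := by
        rw [← Real.exp_add]; congr 1; ring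
      rw [← e2]
      linarith)
  have h1 := hanti (mem_Ici.2 le_rfl) (mem_Ici.2 ht) ht
  have hu0 : u 0 = 0 := by simp [hu]
  simp only [hu0, mul_zero, Real.exp_zero, one_mul] at h1
  have h2 : (1 - 3.4 / 21 : ℝ) ≤ Real.exp (u t) := by
    refine le_trans ?_ (Real.add_one_le_exp (u t))
    have := Real.exp_pos (-21 * t)
    simp only [hu]
    linarith
  have h3 : 0 ≤ Real.exp (8 * t) * energy f g t :=
    mul_nonneg (Real.exp_pos _).le (energy_nonneg t)
  have h4 := (mul_le_mul_of_nonneg_right h2 (by linarith :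
    0 ≤ Real.exp (8 * t) * energy f g t + 24.8)).trans h1
  norm_num at h4 ⊢
  linarith

/-- The mean relation reads σ = (2/π) e^{4t} (∫ wt quot f - ∫ quot f). By Cauchy–Schwarz and
`energy_decay` the first integral is O(e^{-6t}); the second is O(e^{-27t}). -/
lemma abs_gap_le (h : IsFlow f g m)
    (hf : ∀ x > 0, |f 0 x - f 0 0| ≤ K * x ^ 2) (hg : ∀ x > 0, |g 0 x - g 0 0| ≤ K * x ^ 2)
    (h0 : ∫ x in Ioi 0, quot g 0 x = -13 * ∫ x in Ioi 0, quot f 0 x)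
    (hP : |∫ x in Ioi 0, quot f 0 x| ≤ 13 / 5) (hE : energy f g 0 ≤ 25) {t : ℝ} (ht : 0 ≤ t) :
    |f t 0 - m t| ≤ 10 / 3 * Real.exp (-2 * t) + 1.66 * Real.exp (-23 * t) := by
  have hen := h.energy_decay hf hg h0 hP hE ht
  obtain ⟨uf, ug⟩ := h.unifDecays_quot hf hg
  have df := uf.decays ht
  have dg := ug.decays ht
  have hk := h.integral_wt_mul_quot hf hg ht
  have hcs := (decays_wt_traj ht).sq_integral_mul_le df
  rw [integral_wt_sq_traj] at hcs
  have hA : ∫ x in Ioi 0, quot f t x ^ 2 ≤ energy f g t := by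
    refine integral_mono df.sq.integrableOn
      (df.sq.add (dg.sq.const_mul (1 / 130))).integrableOn fun x => ?_
    simp only
    have := sq_nonneg (quot g t x)
    linarith
  rw [h.integral_quot_eq hf hg h0 ht] at hk
  set p := ∫ x in Ioi 0, quot f 0 x
  set k := ∫ x in Ioi 0, wt (x * Real.exp (4 * t)) * quot f t x
  have hpi := Real.pi_gt_d2
  have hpos := Real.pi_pos
  have e12 : Real.exp (-4 * t) * Real.exp (-8 * t) = Real.exp (-6 * t) ^ 2 := by
    rw [← Real.exp_add, ← Real.exp_nat_mul]; congr 1; push_cast; ring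
  have hkb : |k| ≤ 5 * Real.pi / 3 * Real.exp (-6 * t) := by
    refine abs_le_of_sq_le_sq ?_ (by positivity)
    have h8 : Real.exp (-8 * t) * Real.exp (8 * t) = 1 := by rw [← Real.exp_add]; simp
    have h9 : energy f g t ≤ 34.7 * Real.exp (-8 * t) := by
      have := mul_le_mul_of_nonneg_left hen (Real.exp_pos (-8 * t)).le
      rw [← mul_assoc, h8] at this
      linarith
    calc k ^ 2 ≤ Real.exp (-4 * t) * (Real.pi / 4) * (34.7 * Real.exp (-8 * t)) :=
          hcs.trans (mul_le_mul_of_nonneg_left (hA.trans h9) (by positivity))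
      _ = 34.7 * Real.pi / 4 * (Real.exp (-4 * t) * Real.exp (-8 * t)) := by ring
      _ ≤ 25 * Real.pi ^ 2 / 9 * (Real.exp (-4 * t) * Real.exp (-8 * t)) := by
          refine mul_le_mul_of_nonneg_right ?_ (by positivity)
          norm_num at hpi ⊢
          nlinarith
      _ = (5 * Real.pi / 3 * Real.exp (-6 * t)) ^ 2 := by rw [e12]; ring
  have hσ : f t 0 - m t = 2 / Real.pi * Real.exp (4 * t) * k
      - 2 / Real.pi * (Real.exp (4 * t) * Real.exp (-27 * t)) * p := by
    have e4 : Real.exp (4 * t) * Real.exp (-4 * t) = 1 := by rw [← Real.exp_add]; simp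
    rw [hk]
    generalize Real.exp (-4 * t) = a at *
    generalize Real.exp (4 * t) = b at *
    field_simp
    linear_combination (-(Real.pi * (f t 0 - m t))) * e4
  have e5 : Real.exp (4 * t) * Real.exp (-27 * t) = Real.exp (-23 * t) := by
    rw [← Real.exp_add]; congr 1; ring
  have e6 : Real.exp (4 * t) * Real.exp (-6 * t) = Real.exp (-2 * t) := by
    rw [← Real.exp_add]; congr 1; ring
  rw [hσ, e5]
  refine (abs_sub _ _).trans (add_le_add ?_ ?_)
  · rw [abs_mul, abs_of_pos (by positivity : 0 < 2 / Real.pi * Real.exp (4 * t))]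
    calc _ ≤ 2 / Real.pi * Real.exp (4 * t) * (5 * Real.pi / 3 * Real.exp (-6 * t)) := by gcongr
      _ = 10 / 3 * (Real.exp (4 * t) * Real.exp (-6 * t)) := by field_simp; norm_num
      _ = _ := by rw [e6]
  · rw [abs_mul, abs_of_pos (by positivity : 0 < 2 / Real.pi * Real.exp (-23 * t))]
    have : 2 / Real.pi * |p| ≤ 1.66 := by
      rw [div_mul_eq_mul_div, div_le_iff₀ hpos]
      norm_num at hpi ⊢
      linarith
    have := mul_le_mul_of_nonneg_right this (Real.exp_pos (-23 * t)).le
    linarith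

end IsFlow

/-! ### The stationary profile near x = 0. -/

/-- The profile in the variable `x = tan θ`. -/
structure IsSteady (p q : ℝ → ℝ) : Prop where
  cont_fst : Continuous p
  cont_snd : Continuous q
  bounded : ∃ M, ∀ x, |p x| ≤ M ∧ |q x| ≤ M
  deriv_fst : ∀ x > 0, HasDerivAt p ((-6 * p x + q x) / (4 * x)) x
  deriv_snd : ∀ x > 0, HasDerivAt q ((-9 * q x + 130 * wt x * (p x - 2)) / (4 * x)) x
  mean_eq : ∫ x in Ioi 0, wt x * (p x - 2) = 0
  fst_zero : p 0 = 65 / 19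
  snd_zero : q 0 = 390 / 19

namespace IsSteady

variable {p q : ℝ → ℝ}

lemma decays_wt_mul (h : IsSteady p q) : Decays fun x => wt x * (p x - 2) := by
  obtain ⟨M, hM⟩ := h.bounded
  refine (Decays.wt.bdd_mul (ψ := fun x => p x - 2) (M := M + 2)
    (h.cont_fst.sub continuous_const).continuousOn (fun x _ => ?_)).congr (fun x => mul_comm _ _)
  refine (abs_sub _ _).trans ?_
  norm_num
  exact (hM x).1

/-- The unstable component vanishes to second order at `0`, because the average of `p - 2`
vanishes. -/
lemma exists_unstable_le (h : IsSteady p q) :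
    ∃ K, ∀ x > 0, |13 * (p x - p 0) + (q x - q 0)| ≤ K * x ^ 2 := by
  obtain ⟨M, hM⟩ := h.bounded
  have hM0 : 0 ≤ M := (abs_nonneg _).trans (hM 0).1
  refine ⟨65 / 2 * (M + 2), fun x hx => ?_⟩
  -- The linearization at 0 has modes x and x^{-19/4}; 13p + q carries the mode x. Dividing by y
  -- removes it, and φ' reduces to a multiple of wt (p - 2).
  set φ : ℝ → ℝ := fun y => (13 * (p y - p 0) + (q y - q 0)) / y with hφ
  have hd : ∀ y > 0, HasDerivAt φ (-(65 / 2) * (wt y * (p y - 2))) y := fun y hy => by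
    refine (((((h.deriv_fst y hy).sub_const _).const_mul 13).fun_add
      ((h.deriv_snd y hy).sub_const _)).fun_div (hasDerivAt_id y) hy.ne').congr_deriv ?_
    have := sq_mul_wt y
    have hy' : y ≠ 0 := hy.ne'
    rw [h.fst_zero, h.snd_zero]
    simp only [id_eq]
    field_simp
    linear_combination (4940 * (p y - 2)) * this
  have hb : ∀ y, |13 * (p y - p 0) + (q y - q 0)| ≤ 28 * M := fun y => by
    have h1 := abs_le.1 (hM y).1
    have h2 := abs_le.1 (hM y).2
    have h3 := abs_le.1 (hM 0).1
    have h4 := abs_le.1 (hM 0).2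
    rw [abs_le]
    constructor <;> linarith
  have hdec := (h.decays_wt_mul.const_mul (-(65 / 2))).integrableOn
  have hlim : Tendsto φ atTop (𝓝 0) := by
    refine squeeze_zero_norm' (a := fun y => 28 * M * y⁻¹) ?_ ?_
    · filter_upwards [eventually_gt_atTop 0] with y hy
      rw [Real.norm_eq_abs, hφ, abs_div, abs_of_pos hy, ← div_eq_mul_inv]
      gcongr
      exact hb y
    · simpa using tendsto_inv_atTop_zero.const_mul (28 * M)
  have h1 := integral_Ioi_of_hasDerivAt_of_tendsto (a := x)
    (hd x hx).continuousAt.continuousWithinAt (fun y hy => hd y (hx.trans hy))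
    (hdec.mono_set (Ioi_subset_Ioi hx.le)) hlim
  have h2 : ∫ y in Ioi 0, -(65 / 2) * (wt y * (p y - 2)) = 0 := by
    rw [integral_const_mul, h.mean_eq, mul_zero]
  rw [← Ioc_union_Ioi_eq_Ioi hx.le, setIntegral_union (Ioc_disjoint_Ioi le_rfl) measurableSet_Ioi
    (hdec.mono_set Ioc_subset_Ioi_self) (hdec.mono_set (Ioi_subset_Ioi hx.le)), h1] at h2
  -- φ vanishes at infinity and φ' has integral zero over (0, ∞), so φ vanishes at 0⁺ as well and
  -- φ(x) = O(x).
  have h3 : φ x = ∫ y in Ioc 0 x, -(65 / 2) * (wt y * (p y - 2)) := by linarith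
  have h4 : ‖∫ y in Ioc 0 x, -(65 / 2) * (wt y * (p y - 2))‖
      ≤ 65 / 2 * (M + 2) * volume.real (Ioc 0 x) := by
    refine norm_setIntegral_le_of_norm_le_const (by simp) (fun y hy => ?_)
    rw [Real.norm_eq_abs, abs_mul, abs_mul, abs_of_pos (wt_pos y)]
    have h5 : |p y - 2| ≤ M + 2 := by
      have := abs_le.1 (hM y).1
      rw [abs_le]
      constructor <;> linarith
    have h6 := wt_le_one y
    have h7 := wt_pos y
    have h8 : wt y * |p y - 2| ≤ 1 * (M + 2) := by gcongr
    rw [abs_of_neg (by norm_num)]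
    linarith
  rw [← h3, Real.norm_eq_abs, hφ, abs_div, abs_of_pos hx, Real.volume_real_Ioc_of_le hx.le,
    div_le_iff₀ hx] at h4
  calc _ ≤ _ := h4
    _ = _ := by ring

/-- q - 10p carries the mode x^{-19/4}, which boundedness excludes. With x = e^{4s} and integrating
factor e^{19s}, the forcing is O(e^{27s}), where 27 = 19 + 8; integrating from s = -∞ gives O(x²).
-/
lemma exists_stable_le (h : IsSteady p q) :
    ∃ K, ∀ x > 0, |(q x - q 0) - 10 * (p x - p 0)| ≤ K * x ^ 2 := by
  obtain ⟨M, hM⟩ := h.bounded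
  have hM0 : 0 ≤ M := (abs_nonneg _).trans (hM 0).1
  set K := 130 * (M + 2) / 27 with hK
  set φ : ℝ → ℝ := fun s => Real.exp (19 * s) *
    ((q (Real.exp (4 * s)) - q 0) - 10 * (p (Real.exp (4 * s)) - p 0)) with hφ
  have hexp : ∀ c t : ℝ, HasDerivAt (fun s => Real.exp (c * s)) (c * Real.exp (c * t)) t :=
    fun c t => by
      have h1 : HasDerivAt (fun s : ℝ => c * s) c t := by
        simpa using (hasDerivAt_id t).const_mul c
      exact h1.exp.congr_deriv (mul_comm _ _)
  have hd : ∀ s, HasDerivAt φ (-130 * Real.exp (19 * s) * Real.exp (4 * s) ^ 2 *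
      (wt (Real.exp (4 * s)) * (p (Real.exp (4 * s)) - 2))) s := fun s => by
    have hx := Real.exp_pos (4 * s)
    have hp := (h.deriv_fst _ hx).comp s (hexp 4 s)
    have hq := (h.deriv_snd _ hx).comp s (hexp 4 s)
    refine ((hexp 19 s).fun_mul ((hq.sub_const (q 0)).fun_sub
      ((hp.sub_const (p 0)).const_mul 10))).congr_deriv ?_
    have hw := sq_mul_wt (Real.exp (4 * s))
    simp only [Function.comp]
    rw [h.fst_zero, h.snd_zero]
    generalize Real.exp (4 * s) = x at *
    generalize Real.exp (19 * s) = e at *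
    field_simp
    linear_combination (130 * e * (p x - 2)) * hw
  have hb : ∀ s, |(-130 * Real.exp (19 * s) * Real.exp (4 * s) ^ 2 *
      (wt (Real.exp (4 * s)) * (p (Real.exp (4 * s)) - 2)))| ≤ K * (27 * Real.exp (27 * s)) :=
    fun s => by
      have e : Real.exp (19 * s) * Real.exp (4 * s) ^ 2 = Real.exp (27 * s) := by
        rw [← Real.exp_nat_mul, ← Real.exp_add]; congr 1; push_cast; ring
      have h5 : |p (Real.exp (4 * s)) - 2| ≤ M + 2 := by
        have := abs_le.1 (hM (Real.exp (4 * s))).1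
        rw [abs_le]
        constructor <;> linarith
      have h6 := wt_le_one (Real.exp (4 * s))
      have h7 := wt_pos (Real.exp (4 * s))
      have h8 : wt (Real.exp (4 * s)) * |p (Real.exp (4 * s)) - 2| ≤ 1 * (M + 2) := by gcongr
      rw [mul_assoc (-130), e, abs_mul, abs_mul, abs_mul, abs_of_pos h7,
        abs_of_pos (Real.exp_pos _), abs_of_neg (by norm_num : (-130 : ℝ) < 0), hK]
      have := Real.exp_pos (27 * s)
      have := mul_le_mul_of_nonneg_left h8 this.le
      linarith
  have hlim27 : Tendsto (fun s => K * Real.exp (27 * s)) atBot (𝓝 0) := by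
    have : Tendsto (fun s : ℝ => 27 * s) atBot atBot :=
      tendsto_id.const_mul_atBot (by norm_num)
    simpa using (Real.tendsto_exp_atBot.comp this).const_mul K
  have hlim : Tendsto φ atBot (𝓝 0) := by
    refine squeeze_zero_norm (a := fun s => 22 * M * Real.exp (19 * s)) (fun s => ?_) ?_
    · rw [Real.norm_eq_abs, hφ, abs_mul, abs_of_pos (Real.exp_pos _), mul_comm]
      gcongr
      have h1 := abs_le.1 (hM (Real.exp (4 * s))).1
      have h2 := abs_le.1 (hM (Real.exp (4 * s))).2
      have h3 := abs_le.1 (hM 0).1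
      have h4 := abs_le.1 (hM 0).2
      rw [abs_le]
      constructor <;> linarith
    · have : Tendsto (fun s : ℝ => 19 * s) atBot atBot :=
        tendsto_id.const_mul_atBot (by norm_num)
      simpa using (Real.tendsto_exp_atBot.comp this).const_mul (22 * M)
  have a1 : Antitone fun s => φ s - K * Real.exp (27 * s) := by
    refine antitone_of_hasDerivAt_nonpos (fun s => (hd s).fun_sub ((hexp 27 s).const_mul K))
      (fun s => ?_)
    have := (abs_le.1 (hb s)).2
    simp only [Pi.zero_apply]
    linarith
  have a2 : Antitone fun s => -φ s - K * Real.exp (27 * s) := by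
    refine antitone_of_hasDerivAt_nonpos
      (fun s => (hd s).fun_neg.fun_sub ((hexp 27 s).const_mul K)) (fun s => ?_)
    have := (abs_le.1 (hb s)).1
    simp only [Pi.zero_apply]
    linarith
  refine ⟨K, fun x hx => ?_⟩
  obtain ⟨r, rfl⟩ : ∃ r, Real.exp (4 * r) = x :=
    ⟨Real.log x / 4, by rw [mul_div_cancel₀ _ (by norm_num), Real.exp_log hx]⟩
  have e27 : Real.exp (27 * r) = Real.exp (19 * r) * Real.exp (4 * r) ^ 2 := by
    rw [← Real.exp_nat_mul, ← Real.exp_add]; congr 1; push_cast; ring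
  have b1 := a1.ge_of_tendsto (by simpa using hlim.sub hlim27) r
  have b2 := a2.ge_of_tendsto (by simpa using hlim.neg.sub hlim27) r
  simp only [hφ, e27] at b1 b2
  have he := Real.exp_pos (19 * r)
  generalize Real.exp (19 * r) = e at *
  rw [abs_le]
  constructor
  · refine le_of_mul_le_mul_left ?_ he
    linarith
  · refine le_of_mul_le_mul_left ?_ he
    linarith

lemma exists_quadratic_le (h : IsSteady p q) :
    ∃ K, ∀ x > 0, |p x - p 0| ≤ K * x ^ 2 ∧ |q x - q 0| ≤ K * x ^ 2 := by
  obtain ⟨K, hK⟩ := h.exists_unstable_le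
  obtain ⟨L, hL⟩ := h.exists_stable_le
  refine ⟨K + L, fun x hx => ?_⟩
  have h1 := abs_le.1 (hK x hx)
  have h2 := abs_le.1 (hL x hx)
  constructor <;> rw [abs_le] <;> constructor <;> linarith

/-- The quotient `(p(x) - p(0)) / x²`. -/
def sqQuot (p : ℝ → ℝ) (x : ℝ) : ℝ := (p x - p 0) / x ^ 2

lemma decays_sqQuot (h : IsSteady p q) : Decays (sqQuot p) ∧ Decays (sqQuot q) := by
  obtain ⟨K, hK⟩ := h.exists_quadratic_le
  obtain ⟨M, hM⟩ := h.bounded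
  have aux : ∀ {p : ℝ → ℝ}, Continuous p → (∀ x, |p x| ≤ M) →
      (∀ x > 0, |p x - p 0| ≤ K * x ^ 2) → Decays (sqQuot p) := fun {p} hp hM hK => by
    refine ⟨(hp.sub continuous_const).continuousOn.div (by fun_prop)
      (fun x hx => pow_ne_zero 2 (mem_Ioi.1 hx).ne'), K + 2 * M, fun x hx => ?_⟩
    have hx2 : 0 < x ^ 2 := by positivity
    have h1 : |sqQuot p x| * x ^ 2 = |p x - p 0| := by
      rw [sqQuot, abs_div, abs_of_pos hx2, div_mul_cancel₀ _ hx2.ne']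
    have h2 : |sqQuot p x| ≤ K := by
      refine le_of_mul_le_mul_right ?_ hx2
      rw [h1]
      exact hK x hx
    have h3 : |p x - p 0| ≤ 2 * M := (abs_sub _ _).trans (by linarith [hM x, hM 0])
    unfold wt
    rw [← div_eq_mul_inv, le_div_iff₀ (by positivity)]
    linarith
  exact ⟨aux h.cont_fst (fun x => (hM x).1) (fun x hx => (hK x hx).1),
    aux h.cont_snd (fun x => (hM x).2) (fun x hx => (hK x hx).2)⟩

lemma hasDerivAt_sqQuot_fst (h : IsSteady p q) {x : ℝ} (hx : 0 < x) :
    HasDerivAt (sqQuot p) ((-14 * sqQuot p x + sqQuot q x) / 4 / x) x := by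
  refine (((h.deriv_fst x hx).sub_const (p 0)).fun_div (hasDerivAt_pow 2 x)
    (by positivity)).congr_deriv ?_
  rw [sqQuot, sqQuot, h.snd_zero, h.fst_zero]
  field_simp
  push_cast
  ring

lemma hasDerivAt_sqQuot_snd (h : IsSteady p q) {x : ℝ} (hx : 0 < x) :
    HasDerivAt (sqQuot q)
      ((-17 * sqQuot q x + 130 * wt x * (sqQuot p x - 27 / 19)) / 4 / x) x := by
  refine (((h.deriv_snd x hx).sub_const (q 0)).fun_div (hasDerivAt_pow 2 x)
    (by positivity)).congr_deriv ?_
  have hw := sq_mul_wt x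
  rw [sqQuot, sqQuot, h.snd_zero, h.fst_zero]
  field_simp
  push_cast
  linear_combination (3510 * x) * hw

/-- This is the mean condition rewritten through 1 - wt = x² wt; 27/19 is p(0) - 2. -/
lemma integral_sqQuot (h : IsSteady p q) :
    ∫ x in Ioi 0, sqQuot p x = (∫ x in Ioi 0, wt x * sqQuot p x) - 27 / 19 * (Real.pi / 2) := by
  have dp := h.decays_sqQuot.1
  have e : ∀ x ∈ Ioi (0 : ℝ), wt x * (p x - 2) = (sqQuot p x - wt x * sqQuot p x)
      + 27 / 19 * wt x := fun x hx => by
    have hw := sq_mul_wt x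
    have hp : p x - p 0 = sqQuot p x * x ^ 2 := by
      rw [sqQuot, div_mul_cancel₀ _ (pow_ne_zero 2 (mem_Ioi.1 hx).ne')]
    rw [h.fst_zero] at hp
    linear_combination wt x * hp + sqQuot p x * hw
  have h1 := h.mean_eq
  rw [setIntegral_congr_fun measurableSet_Ioi e, integral_add (dp.sub dp.wt_mul).integrableOn
    (Decays.wt.const_mul _).integrableOn, integral_sub dp.integrableOn dp.wt_mul.integrableOn,
    integral_const_mul, integral_wt] at h1
  linarith

/-- Euler integration by parts in the first equation alone. It says that the profile has no
component along the eigenvalue -27 of the moment system. -/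
lemma integral_sqQuot_snd (h : IsSteady p q) :
    ∫ x in Ioi 0, sqQuot q x = 10 * ∫ x in Ioi 0, sqQuot p x := by
  obtain ⟨dp, dq⟩ := h.decays_sqQuot
  have d : Decays fun x => -14 / 4 * sqQuot p x + 1 / 4 * sqQuot q x :=
    (dp.const_mul _).add (dq.const_mul _)
  have h1 := dp.integral_add_euler d (fun x hx => (h.hasDerivAt_sqQuot_fst hx).congr_deriv
    (by ring))
  rw [integral_add (dp.const_mul _).integrableOn (dq.const_mul _).integrableOn,
    integral_const_mul, integral_const_mul] at h1
  linarith

end IsSteady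

/-! ### Approximation of the profile by polynomials in `wt`. -/

/-- A polynomial approximation of the first quotient of the profile. -/
def trialFst : ℝ → ℝ := wtPoly [-177/50, 93/20, -597/100, 117/25, -153/100]

/-- The corresponding approximation of the second quotient. -/
def trialSnd : ℝ → ℝ := wtPoly [-531/25, -1881/50, 1341/10, -5688/25, 9477/50, -306/5]

/-- The residual of the approximation. -/
def trialResidual : ℝ → ℝ :=
  wtPoly [-3051/475, 12633/50, -53628/25, 74073/10, -612423/50, 96777/10, -14688/5]

lemma trialFst_eq (x : ℝ) : trialFst x = (-177/50) * wt x ^ 1 + (93/20) * wt x ^ 2 +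
    (-597/100) * wt x ^ 3 + (117/25) * wt x ^ 4 + (-153/100) * wt x ^ 5 := by
  simp only [trialFst, wtPoly, List.foldr]
  push_cast
  ring

lemma trialSnd_eq (x : ℝ) : trialSnd x = (-531/25) * wt x ^ 1 + (-1881/50) * wt x ^ 2
    + (1341/10) * wt x ^ 3 + (-5688/25) * wt x ^ 4 + (9477/50) * wt x ^ 5 + (-306/5) * wt x ^ 6 := by
  simp only [trialSnd, wtPoly, List.foldr]
  push_cast
  ring

lemma trialResidual_eq (x : ℝ) : trialResidual x = (-3051/475) * wt x ^ 1 + (12633/50) * wt x ^ 2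
    + (-53628/25) * wt x ^ 3 + (74073/10) * wt x ^ 4 + (-612423/50) * wt x ^ 5
    + (96777/10) * wt x ^ 6 + (-14688/5) * wt x ^ 7 := by
  simp only [trialResidual, wtPoly, List.foldr]
  push_cast
  ring

lemma hasDerivAt_wt_pow {x : ℝ} (hx : 0 < x) (n : ℕ) :
    HasDerivAt (fun y => wt y ^ (n + 1))
      (-2 * (n + 1) * (wt x ^ (n + 1) - wt x ^ (n + 2)) / x) x := by
  refine ((hasDerivAt_wt x).fun_pow (n + 1)).congr_deriv ?_
  have h := sq_mul_wt x
  rw [eq_div_iff hx.ne']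
  push_cast
  linear_combination (-2 * ((n : ℝ) + 1) * wt x ^ (n + 1)) * h

/-- `trialSnd` is determined by `trialFst` so that the first equation holds exactly; the whole
residual sits in the second one. -/
lemma hasDerivAt_trialFst {x : ℝ} (hx : 0 < x) :
    HasDerivAt trialFst ((-14 * trialFst x + trialSnd x) / 4 / x) x := by
  have h := fun n => hasDerivAt_wt_pow hx n
  refine (((((((h 0).const_mul (-177/50)).fun_add
    ((h 1).const_mul (93/20))).fun_add
    ((h 2).const_mul (-597/100))).fun_add
    ((h 3).const_mul (117/25))).fun_add
    ((h 4).const_mul (-153/100)))).congr_deriv ?_ |>.congr_of_eventuallyEq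
    (Eventually.of_forall trialFst_eq)
  rw [trialFst_eq, trialSnd_eq]
  push_cast
  ring

lemma hasDerivAt_trialSnd {x : ℝ} (hx : 0 < x) :
    HasDerivAt trialSnd ((-17 * trialSnd x + 130 * wt x * (trialFst x - 27 / 19)
      + trialResidual x) / 4 / x) x := by
  have h := fun n => hasDerivAt_wt_pow hx n
  refine ((((((((h 0).const_mul (-531/25)).fun_add
    ((h 1).const_mul (-1881/50))).fun_add
    ((h 2).const_mul (1341/10))).fun_add
    ((h 3).const_mul (-5688/25))).fun_add
    ((h 4).const_mul (9477/50))).fun_add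
    ((h 5).const_mul (-306/5)))).congr_deriv ?_ |>.congr_of_eventuallyEq
    (Eventually.of_forall trialSnd_eq)
  rw [trialFst_eq, trialSnd_eq, trialResidual_eq]
  push_cast
  ring

lemma integral_trialResidual_sq_le : ∫ x in Ioi 0, trialResidual x ^ 2 ≤ 0.61 := by
  have e : ∀ x, trialResidual x ^ 2 = wtPoly [0, 9308601/225625, -38543283/11875, 868242663/9500,
      -14002151571/11875, 201921175593/23750, -904704222051/23750, 5336387453529/47500,
      -56115029799/250, 764997589539/2500, -70148302911/250, 82810014741/500, -1421460576/25,
      215737344/25] x := fun x => by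
    simp only [trialResidual_eq, wtPoly, List.foldr]
    push_cast
    ring
  simp_rw [e]
  rw [integral_wtPoly]
  set l : List ℚ := [0, 9308601/225625, -38543283/11875, 868242663/9500,
      -14002151571/11875, 201921175593/23750, -904704222051/23750, 5336387453529/47500,
      -56115029799/250, 764997589539/2500, -70148302911/250, 82810014741/500, -1421460576/25,
      215737344/25] with hl
  have h : (momentSum 0 l : ℚ) ≤ 0.387 := by
    rw [hl]
    norm_num [momentSum, wtMoment]
  have h' : ((momentSum 0 l : ℚ) : ℝ) ≤ 0.387 := by
    have := (Rat.cast_le (K := ℝ)).2 h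
    norm_num at this ⊢
    exact this
  have := Real.pi_lt_d2
  have := Real.pi_pos
  nlinarith

/-- Energy estimate for the stationary linear system with right-hand side `r`. -/
lemma integral_sq_le_of_euler_system {a b r : ℝ → ℝ} (da : Decays a) (db : Decays b)
    (dr : Decays r)
    (ha : ∀ x > 0, HasDerivAt a ((-14 * a x + b x) / 4 / x) x)
    (hb : ∀ x > 0, HasDerivAt b ((-17 * b x + 130 * wt x * a x - r x) / 4 / x) x) :
    144 * (∫ x in Ioi 0, a x ^ 2) ≤ ∫ x in Ioi 0, b x ^ 2 ∧
      17 * (∫ x in Ioi 0, b x ^ 2) ≤ ∫ x in Ioi 0, r x ^ 2 := by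
  have h1 := da.sq.integral_add_euler (ψ := fun x => -7 * a x ^ 2 + 1 / 2 * (a x * b x))
    ((da.sq.const_mul _).add ((da.mul db).const_mul _))
    (fun x hx => ((ha x hx).fun_pow 2).congr_deriv (by push_cast; ring))
  have h2 := db.sq.integral_add_euler
    (ψ := fun x => (-17 / 2 * b x ^ 2 + 65 * (wt x * (a x * b x))) + -1 / 2 * (r x * b x))
    (((db.sq.const_mul _).add ((da.mul db).wt_mul.const_mul _)).add ((dr.mul db).const_mul _))
    (fun x hx => ((hb x hx).fun_pow 2).congr_deriv (by push_cast; ring))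
  rw [integral_add (da.sq.const_mul _).integrableOn ((da.mul db).const_mul _).integrableOn,
    integral_const_mul, integral_const_mul] at h1
  rw [integral_add ((db.sq.const_mul _).add ((da.mul db).wt_mul.const_mul _)).integrableOn
    ((dr.mul db).const_mul _).integrableOn, integral_add (db.sq.const_mul _).integrableOn
    ((da.mul db).wt_mul.const_mul _).integrableOn,
    integral_const_mul, integral_const_mul, integral_const_mul] at h2
  -- By `h1`, ∫ ab = 12 ∫ a², so this Young inequality yields 144 ∫ a² ≤ ∫ b². The same weights in
  -- `h4` then bound 65 ∫ wt ab by (65/12) ∫ b².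
  have h3 : ∫ x in Ioi 0, a x * b x ≤ ∫ x in Ioi 0, (6 * a x ^ 2 + 1 / 24 * b x ^ 2) :=
    integral_mono (da.mul db).integrableOn
      ((da.sq.const_mul _).add (db.sq.const_mul _)).integrableOn
      (fun x => by simp only; nlinarith [sq_nonneg (12 * a x - b x)])
  have h4 : ∫ x in Ioi 0, wt x * (a x * b x) ≤ ∫ x in Ioi 0, (6 * a x ^ 2 + 1 / 24 * b x ^ 2) :=
    integral_mono (da.mul db).wt_mul.integrableOn
      ((da.sq.const_mul _).add (db.sq.const_mul _)).integrableOn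
      (fun x => by
        simp only
        have e : a x * b x ≤ 6 * a x ^ 2 + 1 / 24 * b x ^ 2 := by
          nlinarith [sq_nonneg (12 * a x - b x)]
        have hw := wt_pos x
        have hw1 := wt_le_one x
        have : 0 ≤ 6 * a x ^ 2 + 1 / 24 * b x ^ 2 := by positivity
        nlinarith)
  -- The weight 25/12 is the remaining coercivity 15/2 - 65/12; half of it is spent on the residual.
  have h5 : ∫ x in Ioi 0, -(r x * b x) ≤ ∫ x in Ioi 0, (25 / 12 * b x ^ 2 + 3 / 25 * r x ^ 2) :=
    integral_mono ((dr.mul db).const_mul (-1) |>.congr fun x => by ring).integrableOn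
      ((db.sq.const_mul _).add (dr.sq.const_mul _)).integrableOn
      (fun x => by simp only; nlinarith [sq_nonneg (25 * b x + 6 * r x)])
  rw [integral_add (da.sq.const_mul _).integrableOn (db.sq.const_mul _).integrableOn,
    integral_const_mul, integral_const_mul] at h3 h4
  rw [integral_add (db.sq.const_mul _).integrableOn (dr.sq.const_mul _).integrableOn,
    integral_const_mul, integral_const_mul, integral_neg] at h5
  have h6 : 0 ≤ ∫ x in Ioi 0, r x ^ 2 := integral_nonneg fun x => sq_nonneg _
  constructor <;> linarith

namespace IsSteady

variable {p q : ℝ → ℝ}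

/-- The approximation errors decay and are small in `L²`. -/
lemma exists_error (h : IsSteady p q) : ∃ a b : ℝ → ℝ, Decays a ∧ Decays b ∧
    (∀ x, sqQuot p x = trialFst x + a x) ∧ (∀ x, sqQuot q x = trialSnd x + b x) ∧
    144 * (∫ x in Ioi 0, a x ^ 2) ≤ ∫ x in Ioi 0, b x ^ 2 ∧
      ∫ x in Ioi 0, b x ^ 2 ≤ 0.036 := by
  obtain ⟨dp, dq⟩ := h.decays_sqQuot
  have da : Decays fun x => sqQuot p x - trialFst x := dp.sub (Decays.wtPoly _)
  have db : Decays fun x => sqQuot q x - trialSnd x := dq.sub (Decays.wtPoly _)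
  have dr : Decays trialResidual := Decays.wtPoly _
  refine ⟨_, _, da, db, fun x => by ring, fun x => by ring, ?_⟩
  obtain ⟨h1, h2⟩ := integral_sq_le_of_euler_system da db dr
    (fun x hx => ((h.hasDerivAt_sqQuot_fst hx).fun_sub (hasDerivAt_trialFst hx)).congr_deriv
      (by ring))
    (fun x hx => ((h.hasDerivAt_sqQuot_snd hx).fun_sub (hasDerivAt_trialSnd hx)).congr_deriv
      (by ring))
  have h3 := integral_trialResidual_sq_le
  refine ⟨h1, ?_⟩
  norm_num at h3 ⊢
  linarith

/-- `integral_sqQuot` replaces the plain integral by a weighted one, whose approximation error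
Cauchy–Schwarz against `wt` controls by 0.02. -/
lemma abs_integral_sqQuot_le (h : IsSteady p q) : |∫ x in Ioi 0, sqQuot p x| ≤ 3.98 := by
  obtain ⟨a, b, da, db, ea, eb, hA, hB⟩ := h.exists_error
  have dt : Decays trialFst := Decays.wtPoly _
  have h1 := h.integral_sqQuot
  have e : ∀ x, wt x * sqQuot p x = wt x ^ 1 * trialFst x + wt x * a x := fun x => by
    rw [ea]; ring
  have h2 : Decays (fun x => wt x ^ 1 * trialFst x) := (integral_wt_pow_mul_wtPoly _ 1).1
  have h3 : ∫ x in Ioi 0, wt x ^ 1 * trialFst x = Real.pi / 2 * ((-63277.5 / 64000 : ℝ)) := by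
    rw [trialFst, (integral_wt_pow_mul_wtPoly _ 1).2]
    norm_num [momentSum, wtMoment]
  have h4 := Decays.wt.sq_integral_mul_le da
  rw [integral_wt_pow 1] at h4
  have h5 : ((wtMoment 1 : ℚ) : ℝ) = 1 / 2 := by norm_num [wtMoment]
  simp_rw [e] at h1
  rw [integral_add h2.integrableOn da.wt_mul.integrableOn, h3] at h1
  have h6 := Real.pi_lt_d2
  have h7 := Real.pi_gt_d2
  rw [h5] at h4
  have h8 : (∫ x in Ioi 0, wt x * a x) ^ 2 ≤ 0.02 ^ 2 := by
    refine h4.trans ?_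
    have : 0 ≤ ∫ x in Ioi 0, a x ^ 2 := integral_nonneg fun x => sq_nonneg _
    norm_num at *
    nlinarith
  have h9 := abs_le.1 (abs_le_of_sq_le_sq h8 (by norm_num))
  rw [h1, abs_le]
  norm_num at *
  constructor <;> linarith

end IsSteady

/-! ### Moments and energy of the initial data. -/

/-- The approximation of `dataFst`. -/
def trialDataFst : ℝ → ℝ := wtPoly [10797/1150, -103713/2300, 9273/92, -80622/575, 237861/2300, -153/5]

/-- The approximation of `dataSnd`. -/
def trialDataSnd : ℝ → ℝ := wtPoly [60489/2185, -4017/230, -41925/92, 413049/460, -88218/115, 113373/460]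

/-- The energy density of the approximate data. -/
def trialDensity : ℝ → ℝ :=
  wtPoly [0, 44898203619/477422500, -21462906969/25127500, 375328580481/100510000,
    -281880828999/25127500, 5181445307133/201020000, -233556100551/5290000,
    579581803593/10580000, -251246031741/5290000, 71964080883/2645000,
    -610853724/66125, 2970063693/2116000]

lemma trialDataFst_eq (x : ℝ) :
    trialDataFst x = 1 / 2 * trialSnd x - 130 / 23 * trialFst x := by
  rw [trialFst_eq, trialSnd_eq]
  simp only [trialDataFst, wtPoly, List.foldr]
  push_cast
  ring

lemma trialDataSnd_eq (x : ℝ) :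
    trialDataSnd x = 65 * wt x * (trialFst x - 27 / 19) - 130 / 23 * trialSnd x := by
  rw [trialFst_eq, trialSnd_eq]
  simp only [trialDataSnd, wtPoly, List.foldr]
  push_cast
  ring

lemma trialDensity_eq (x : ℝ) :
    trialDensity x = trialDataFst x ^ 2 + 1 / 130 * trialDataSnd x ^ 2 := by
  simp only [trialDensity, trialDataFst, trialDataSnd, wtPoly, List.foldr]
  push_cast
  ring

lemma integral_trialDensity_le : ∫ x in Ioi 0, trialDensity x ≤ 20 := by
  unfold trialDensity
  rw [integral_wtPoly]
  set l : List ℚ := [0, 44898203619/477422500, -21462906969/25127500, 375328580481/100510000,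
      -281880828999/25127500, 5181445307133/201020000, -233556100551/5290000,
      579581803593/10580000, -251246031741/5290000, 71964080883/2645000,
      -610853724/66125, 2970063693/2116000] with hl
  have h : (momentSum 0 l : ℚ) ≤ 12.5 := by
    rw [hl]
    norm_num [momentSum, wtMoment]
  have h' : ((momentSum 0 l : ℚ) : ℝ) ≤ 12.5 := by
    have := (Rat.cast_le (K := ℝ)).2 h
    norm_num at this ⊢
    exact this
  have := Real.pi_lt_d2
  have := Real.pi_pos
  nlinarith

namespace IsSteady

variable {p q : ℝ → ℝ}

/-- The first quotient of the initial data. -/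
def dataFst (p q : ℝ → ℝ) (x : ℝ) : ℝ := 1 / 2 * sqQuot q x - 130 / 23 * sqQuot p x

/-- The second quotient of the initial data. -/
def dataSnd (p q : ℝ → ℝ) (x : ℝ) : ℝ :=
  65 * wt x * (sqQuot p x - 27 / 19) - 130 / 23 * sqQuot q x

lemma decays_dataFst (h : IsSteady p q) : Decays (dataFst p q) := by
  obtain ⟨dp, dq⟩ := h.decays_sqQuot
  exact (dq.const_mul _).sub (dp.const_mul _)

lemma decays_dataSnd (h : IsSteady p q) : Decays (dataSnd p q) := by
  obtain ⟨dp, dq⟩ := h.decays_sqQuot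
  exact (((dp.wt_mul.const_mul 65).sub (Decays.wt.const_mul (65 * 27 / 19))).congr
    (ψ := fun x => 65 * wt x * (sqQuot p x - 27 / 19)) (fun x => by ring)).sub
    (dq.const_mul (130 / 23))

lemma exists_data_bound (h : IsSteady p q) :
    ∃ K, ∀ x > 0, |dataFst p q x| ≤ K ∧ |dataSnd p q x| ≤ K := by
  obtain ⟨K, hK⟩ := h.decays_dataFst.bounded
  obtain ⟨L, hL⟩ := h.decays_dataSnd.bounded
  exact ⟨max K L, fun x hx => ⟨(hK x hx).trans (le_max_left _ _),
    (hL x hx).trans (le_max_right _ _)⟩⟩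

lemma integral_dataFst (h : IsSteady p q) :
    ∫ x in Ioi 0, dataFst p q x = -(15 / 23) * ∫ x in Ioi 0, sqQuot p x := by
  obtain ⟨dp, dq⟩ := h.decays_sqQuot
  simp only [dataFst]
  rw [integral_sub (dq.const_mul _).integrableOn (dp.const_mul _).integrableOn,
    integral_const_mul, integral_const_mul, h.integral_sqQuot_snd]
  ring

lemma abs_integral_dataFst_le (h : IsSteady p q) : |∫ x in Ioi 0, dataFst p q x| ≤ 13 / 5 := by
  have h1 := h.abs_integral_sqQuot_le
  rw [h.integral_dataFst, abs_mul, abs_of_neg (by norm_num : (-(15 / 23) : ℝ) < 0)]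
  norm_num at *
  linarith

/-- The coefficient 130/23 = 1/2 + 237/46 in the data is chosen for this identity: it puts the
initial moments in the eigenspace of -27. -/
lemma integral_dataSnd (h : IsSteady p q) :
    ∫ x in Ioi 0, dataSnd p q x = -13 * ∫ x in Ioi 0, dataFst p q x := by
  obtain ⟨dp, dq⟩ := h.decays_sqQuot
  have e : ∀ x, dataSnd p q x
      = (65 * (wt x * sqQuot p x) - 65 * 27 / 19 * wt x) - 130 / 23 * sqQuot q x := fun x => by
    rw [dataSnd]; ring
  simp_rw [e]
  rw [h.integral_dataFst, integral_sub
    ((dp.wt_mul.const_mul _).sub (Decays.wt.const_mul _)).integrableOn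
    (dq.const_mul _).integrableOn, integral_sub (dp.wt_mul.const_mul _).integrableOn
    (Decays.wt.const_mul _).integrableOn, integral_const_mul, integral_const_mul,
    integral_const_mul, h.integral_sqQuot_snd, integral_wt]
  linear_combination -65 * h.integral_sqQuot

/-- The weighted Young inequality with factors 11/10 and 11 charges at most 22 to the trial data;
the approximation errors add less than 1. -/
lemma integral_data_sq_le (h : IsSteady p q) :
    ∫ x in Ioi 0, (dataFst p q x ^ 2 + 1 / 130 * dataSnd p q x ^ 2) ≤ 25 := by
  obtain ⟨a, b, da, db, ea, eb, hA, hB⟩ := h.exists_error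
  have dt : Decays trialDensity := Decays.wtPoly _
  have key : ∀ x, dataFst p q x ^ 2 + 1 / 130 * dataSnd p q x ^ 2
      ≤ 11 / 10 * trialDensity x + (1500 * a x ^ 2 + 11 * b x ^ 2) := fun x => by
    have e1 : dataFst p q x = trialDataFst x + (1 / 2 * b x - 130 / 23 * a x) := by
      rw [dataFst, ea, eb, trialDataFst_eq]; ring
    have e2 : dataSnd p q x = trialDataSnd x + (65 * (wt x * a x) - 130 / 23 * b x) := by
      rw [dataSnd, ea, eb, trialDataSnd_eq]; ring
    have yg : ∀ u v : ℝ, (u + v) ^ 2 ≤ 11 / 10 * u ^ 2 + 11 * v ^ 2 := fun u v => by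
      nlinarith [sq_nonneg (u - 10 * v)]
    have h1 := yg (trialDataFst x) (1 / 2 * b x - 130 / 23 * a x)
    have h2 := yg (trialDataSnd x) (65 * (wt x * a x) - 130 / 23 * b x)
    have h3 : (1 / 2 * b x - 130 / 23 * a x) ^ 2 ≤ 1 / 2 * b x ^ 2 + 64 * a x ^ 2 := by
      nlinarith [sq_nonneg (1 / 2 * b x + 130 / 23 * a x), sq_nonneg (a x)]
    have hw : (wt x * a x) ^ 2 ≤ a x ^ 2 := by
      rw [mul_pow]
      exact mul_le_of_le_one_left (sq_nonneg _) (pow_le_one₀ (wt_pos x).le (wt_le_one x))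
    have h4 : (65 * (wt x * a x) - 130 / 23 * b x) ^ 2 ≤ 8450 * a x ^ 2 + 64 * b x ^ 2 := by
      nlinarith [sq_nonneg (65 * (wt x * a x) + 130 / 23 * b x), sq_nonneg (b x)]
    rw [e1, e2, trialDensity_eq]
    nlinarith [sq_nonneg (a x), sq_nonneg (b x)]
  have h1 := integral_mono (h.decays_dataFst.sq.add (h.decays_dataSnd.sq.const_mul _)).integrableOn
    ((dt.const_mul _).add ((da.sq.const_mul _).add (db.sq.const_mul _))).integrableOn key
  rw [integral_add (dt.const_mul _).integrableOn
    ((da.sq.const_mul _).add (db.sq.const_mul _)).integrableOn,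
    integral_add (da.sq.const_mul _).integrableOn (db.sq.const_mul _).integrableOn,
    integral_const_mul, integral_const_mul, integral_const_mul] at h1
  have h2 := integral_trialDensity_le
  refine h1.trans ?_
  norm_num at hB ⊢
  linarith

end IsSteady

/-! ### From the angular profile to the half-line. -/

namespace IsProfile

variable {Γ : ℝ → ℝ × ℝ}

lemma D_fst (h : IsProfile Γ) {θ : ℝ} (hθ : θ ∈ Ioo 0 (Real.pi / 2)) :
    D (fun s => (Γ s).1) θ = (-6 * (Γ θ).1 + (Γ θ).2) / 2 := by
  have h1 := congrArg Prod.fst (h.eqn θ hθ)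
  simp only [Ltheta, Prod.fst_zero] at h1
  linarith

lemma D_snd (h : IsProfile Γ) {θ : ℝ} (hθ : θ ∈ Ioo 0 (Real.pi / 2)) :
    D (fun s => (Γ s).2) θ = (-9 * (Γ θ).2 + 130 * Real.cos θ ^ 2 * ((Γ θ).1 - 2)) / 2 := by
  have h1 := congrArg Prod.snd (h.eqn θ hθ)
  simp only [Ltheta, Prod.snd_zero, h.avg_eq] at h1
  linarith

/-- The data `F^*` without derivatives; continuity of the evolution extends this to `θ = 0`. -/
lemma evolution_zero_eq (h : IsProfile Γ) {A : (ℝ → ℝ × ℝ) → ℝ → ℝ × ℝ} {U : ℝ → ℝ → ℝ × ℝ}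
    (hU : IsEvolution A (Fstar Γ) U) {θ : ℝ} (hθ : θ ∈ Icc 0 (Real.pi / 2)) :
    U 0 θ = (1 / 2 * ((Γ θ).2 - (Γ θ).1),
      65 * Real.cos θ ^ 2 * ((Γ θ).1 - 2) - 1 / 2 * (Γ θ).2) := by
  have hpi : (0 : ℝ) < Real.pi / 2 := by positivity
  have c1 : ContinuousOn (U 0) (Icc 0 (Real.pi / 2)) :=
    hU.continuousOn.comp (f := fun θ => ((0 : ℝ), θ)) (by fun_prop)
      (fun θ hθ => ⟨mem_Ici.2 le_rfl, hθ⟩)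
  have c2 : ContinuousOn (fun θ => ((1 / 2 * ((Γ θ).2 - (Γ θ).1),
      65 * Real.cos θ ^ 2 * ((Γ θ).1 - 2) - 1 / 2 * (Γ θ).2) : ℝ × ℝ)) (Icc 0 (Real.pi / 2)) := by
    have := h.continuousOn.fst
    have := h.continuousOn.snd
    fun_prop
  have e : EqOn (U 0) (fun θ => ((1 / 2 * ((Γ θ).2 - (Γ θ).1),
      65 * Real.cos θ ^ 2 * ((Γ θ).1 - 2) - 1 / 2 * (Γ θ).2) : ℝ × ℝ)) (Ioo 0 (Real.pi / 2)) := by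
    intro θ hθ
    rw [hU.initial θ (Ioo_subset_Icc_self hθ), Fstar, h.D_fst hθ, h.D_snd hθ]
    ext <;> simp only <;> ring
  exact e.of_subset_closure c1 c2 Ioo_subset_Icc_self (by rw [closure_Ioo hpi.ne]) hθ

/-- At θ = 0 the convention D = 0 gives F^* directly, while continuity of the evolution at t = 0
gives the limit of its derivative-free form. Equating the two yields Γ₂ = 6Γ₁ and a linear equation
for Γ₁. -/
lemma apply_zero (h : IsProfile Γ) {A : (ℝ → ℝ × ℝ) → ℝ → ℝ × ℝ} {U : ℝ → ℝ → ℝ × ℝ}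
    (hU : IsEvolution A (Fstar Γ) U) : (Γ 0).1 = 65 / 19 ∧ (Γ 0).2 = 390 / 19 := by
  have h0 : (0 : ℝ) ∈ Icc 0 (Real.pi / 2) := ⟨le_rfl, by positivity⟩
  have h1 := h.evolution_zero_eq hU h0
  rw [hU.initial 0 h0, Fstar, D, D, Prod.mk.injEq] at h1
  simp only [mul_zero, Real.sin_zero, zero_mul, Real.cos_zero] at h1
  obtain ⟨h1, h2⟩ := h1
  constructor <;> linarith

/-- The profile in the variable `x = tan θ`. -/
lemma isSteady (h : IsProfile Γ) {A : (ℝ → ℝ × ℝ) → ℝ → ℝ × ℝ} {U : ℝ → ℝ → ℝ × ℝ}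
    (hU : IsEvolution A (Fstar Γ) U) :
    IsSteady (fun x => (Γ (Real.arctan |x|)).1) (fun x => (Γ (Real.arctan |x|)).2) := by
  have hc : Continuous fun x => Γ (Real.arctan |x|) :=
    h.continuousOn.comp_continuous (Real.continuous_arctan.comp continuous_abs) arctan_abs_mem
  have key : ∀ x > 0, HasDerivAt (fun y => Γ (Real.arctan |y|))
      ((1 / (1 + x ^ 2)) • deriv Γ (Real.arctan x)) x ∧
      D (fun s => (Γ s).1) (Real.arctan x) = 2 * x * wt x * (deriv Γ (Real.arctan x)).1 ∧
      D (fun s => (Γ s).2) (Real.arctan x) = 2 * x * wt x * (deriv Γ (Real.arctan x)).2 :=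
    fun x hx => by
      have hd := (h.differentiableAt (Real.arctan x)
        ⟨Real.arctan_pos.2 hx, Real.arctan_lt_pi_div_two x⟩).hasDerivAt
      refine ⟨(hd.scomp x (Real.hasDerivAt_arctan x)).congr_of_eventuallyEq ?_, ?_, ?_⟩
      · filter_upwards [Ioi_mem_nhds hx] with y hy
        rw [abs_of_pos (mem_Ioi.1 hy)]
        rfl
      · rw [D, (hasDerivAt_fst hd).deriv, sin_two_mul_arctan]
      · rw [D, (hasDerivAt_snd hd).deriv, sin_two_mul_arctan]
  have hmem : ∀ x > 0, Real.arctan x ∈ Ioo 0 (Real.pi / 2) := fun x hx =>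
    ⟨Real.arctan_pos.2 hx, Real.arctan_lt_pi_div_two x⟩
  refine ⟨hc.fst, hc.snd, ?_, ?_, ?_, ?_, ?_, ?_⟩
  · obtain ⟨M, hM⟩ := isCompact_Icc.exists_bound_of_continuousOn h.continuousOn
    exact ⟨M, fun x => ⟨(norm_fst_le _).trans (hM _ (arctan_abs_mem x)),
      (norm_snd_le _).trans (hM _ (arctan_abs_mem x))⟩⟩
  · intro x hx
    obtain ⟨h1, h2, -⟩ := key x hx
    refine (hasDerivAt_fst h1).congr_deriv ?_
    rw [h.D_fst (hmem x hx)] at h2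
    rw [abs_of_pos hx, Prod.smul_fst, smul_eq_mul, one_div, ← wt, eq_div_iff (by positivity)]
    linear_combination (-2) * h2
  · intro x hx
    obtain ⟨h1, -, h2⟩ := key x hx
    refine (hasDerivAt_snd h1).congr_deriv ?_
    rw [h.D_snd (hmem x hx), Real.cos_sq_arctan, one_div, ← wt] at h2
    rw [abs_of_pos hx, Prod.smul_snd, smul_eq_mul, one_div, ← wt, eq_div_iff (by positivity)]
    linear_combination (-2) * h2
  · have h1 := avg_eq_integral_arctan (fun θ => (Γ θ).1)
    rw [h.avg_eq] at h1
    have e : ∀ x ∈ Ioi (0 : ℝ), wt x * ((Γ (Real.arctan |x|)).1 - 2)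
        = wt x * (Γ (Real.arctan x)).1 - 2 * wt x := fun x hx => by
      rw [abs_of_pos (mem_Ioi.1 hx)]; ring
    have hi : IntegrableOn (fun x => wt x * (Γ (Real.arctan x)).1) (Ioi 0) :=
      ((h.isEvolution.isFlow.decays_wt_mul_fst le_rfl).integrableOn).congr_fun
        (fun x hx => by simp only [abs_of_pos (mem_Ioi.1 hx)]) measurableSet_Ioi
    rw [setIntegral_congr_fun measurableSet_Ioi e,
      integral_sub hi (Decays.wt.const_mul 2).integrableOn, h1, integral_const_mul, integral_wt]
    ring
  · simpa using (h.apply_zero hU).1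
  · simpa using (h.apply_zero hU).2

/-- The evolution of `F^*`, up to a multiple of the stationary profile: the component of the
moments that does not decay has been removed. -/
lemma exists_isFlow (h : IsProfile Γ) {U : ℝ → ℝ → ℝ × ℝ}
    (hU : IsEvolution Ltheta (Fstar Γ) U) : ∃ f g : ℝ → ℝ → ℝ, ∃ m : ℝ → ℝ, IsFlow f g m ∧
      f 0 0 = -3965 / 437 ∧ g 0 0 = -10335 / 437 ∧
      (∀ t ≥ 0, avg (fun θ => (U t θ).1) = 237 / 23 + m t) ∧
      ∀ t ≥ 0, |f t 0 - m t| ≤ 10 / 3 * Real.exp (-2 * t) + 1.66 * Real.exp (-23 * t) := by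
  have hs := h.isSteady hU
  set p := fun x => (Γ (Real.arctan |x|)).1 with hp
  set q := fun x => (Γ (Real.arctan |x|)).2 with hq
  -- The multiple 237/46 makes 13P + Q vanish initially; since Γ₁ has mean 2, it shifts the mean by
  -- 237/23.
  have hflow := hU.isFlow.sub_smul h.isEvolution.isFlow (237 / 46)
  set f : ℝ → ℝ → ℝ := fun t x => (U (max t 0) (Real.arctan |x|)).1
    - 237 / 46 * (Γ (Real.arctan |x|)).1 with hf
  set g : ℝ → ℝ → ℝ := fun t x => (U (max t 0) (Real.arctan |x|)).2
    - 237 / 46 * (Γ (Real.arctan |x|)).2 with hg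
  have hf0 : ∀ x, f 0 x = 1 / 2 * q x - 130 / 23 * p x := fun x => by
    simp only [hf, hp, hq, max_self, h.evolution_zero_eq hU (arctan_abs_mem x)]
    ring
  have hg0 : ∀ x, g 0 x = 65 * wt x * (p x - 2) - 130 / 23 * q x := fun x => by
    simp only [hg, hp, hq, max_self, h.evolution_zero_eq hU (arctan_abs_mem x),
      Real.cos_sq_arctan, sq_abs, one_div, wt]
    ring
  have w0 : wt 0 = 1 := by simp [wt]
  have ef : ∀ x > 0, f 0 x - f 0 0 = IsSteady.dataFst p q x * x ^ 2 := fun x hx => by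
    rw [hf0, hf0, IsSteady.dataFst, IsSteady.sqQuot, IsSteady.sqQuot]
    field_simp
    ring
  have eg : ∀ x > 0, g 0 x - g 0 0 = IsSteady.dataSnd p q x * x ^ 2 := fun x hx => by
    have hw := sq_mul_wt x
    rw [hg0, hg0, IsSteady.dataSnd, IsSteady.sqQuot, IsSteady.sqQuot, w0, hs.fst_zero]
    field_simp
    linear_combination (40365 : ℝ) * hw
  have qf : ∀ x ∈ Ioi (0 : ℝ), quot f 0 x = IsSteady.dataFst p q x := fun x hx => by
    rw [quot]
    simp only [mul_zero, Real.exp_zero, mul_one]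
    rw [ef x hx, mul_div_cancel_right₀ _ (pow_ne_zero 2 (mem_Ioi.1 hx).ne')]
  have qg : ∀ x ∈ Ioi (0 : ℝ), quot g 0 x = IsSteady.dataSnd p q x := fun x hx => by
    rw [quot]
    simp only [mul_zero, Real.exp_zero, mul_one]
    rw [eg x hx, mul_div_cancel_right₀ _ (pow_ne_zero 2 (mem_Ioi.1 hx).ne')]
  have If := setIntegral_congr_fun (μ := volume) measurableSet_Ioi qf
  have Ig := setIntegral_congr_fun (μ := volume) measurableSet_Ioi qg
  obtain ⟨K, hK⟩ := hs.exists_data_bound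
  refine ⟨f, g, _, hflow, ?_, ?_, fun t ht => ?_, fun t ht => ?_⟩
  · rw [hf0, hs.fst_zero, hs.snd_zero]; norm_num
  · rw [hg0, hs.fst_zero, hs.snd_zero, w0]; norm_num
  · simp only [max_eq_left ht, h.avg_eq]; ring
  · refine hflow.abs_gap_le (K := K) (fun x hx => ?_) (fun x hx => ?_) ?_ ?_ ?_ ht
    · rw [ef x hx, abs_mul, abs_of_pos (by positivity : 0 < x ^ 2)]
      exact mul_le_mul_of_nonneg_right (hK x hx).1 (by positivity)
    · rw [eg x hx, abs_mul, abs_of_pos (by positivity : 0 < x ^ 2)]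
      exact mul_le_mul_of_nonneg_right (hK x hx).2 (by positivity)
    · rw [If, Ig]; exact hs.integral_dataSnd
    · rw [If]; exact hs.abs_integral_dataFst_le
    · rw [IsFlow.energy]
      refine le_of_eq_of_le (setIntegral_congr_fun measurableSet_Ioi fun x hx => ?_)
        hs.integral_data_sq_le
      simp only [qf x hx, qg x hx]

end IsProfile

/-! ### The system at x = 0 and positivity. -/

namespace IsFlow

variable {f g : ℝ → ℝ → ℝ} {m : ℝ → ℝ}

/-- Comparison for g' = -9g + 130σ at x = 0: the slow part of σ contributes 130 · (10/3) / (9 - 2) =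
1300/21, and the initial value leaves room for the e^{-23t} part. -/
lemma neg_le_snd_zero (h : IsFlow f g m) (hg : g 0 0 = -10335 / 437)
    (hs : ∀ t ≥ 0, |f t 0 - m t| ≤ 10 / 3 * Real.exp (-2 * t) + 1.66 * Real.exp (-23 * t))
    {t : ℝ} (ht : 0 ≤ t) : -(1300 / 21) * Real.exp (-2 * t) ≤ g t 0 := by
  have h1 := le_of_hasDerivAt_nonneg
    (φ := fun t => Real.exp (9 * t) * g t 0 + 1300 / 21 * Real.exp (7 * t)
      - 1.66 * 65 / 7 * Real.exp (-14 * t))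
    (by have := h.continuous_snd_zero; fun_prop)
    (fun s hs => (((hasDerivAt_exp_mul 9 s).fun_mul (h.hasDerivAt_snd_zero hs)).fun_add
      ((hasDerivAt_exp_mul 7 s).const_mul _)).fun_sub ((hasDerivAt_exp_mul (-14) s).const_mul _))
    (fun s hs0 => by
      have e1 : Real.exp (7 * s) = Real.exp (9 * s) * Real.exp (-2 * s) := by
        rw [← Real.exp_add]; congr 1; ring
      have e2 : Real.exp (-14 * s) = Real.exp (9 * s) * Real.exp (-23 * s) := by
        rw [← Real.exp_add]; congr 1; ring
      have := mul_nonneg (Real.exp_pos (9 * s)).le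
        (sub_nonneg.2 (neg_le.1 (neg_le_of_abs_le (hs s hs0.le))))
      rw [e1, e2]
      linarith) ht
  simp only [mul_zero, Real.exp_zero, hg] at h1
  have e1 : Real.exp (7 * t) = Real.exp (9 * t) * Real.exp (-2 * t) := by
    rw [← Real.exp_add]; congr 1; ring
  rw [e1] at h1
  have := Real.exp_pos (-14 * t)
  refine le_of_mul_le_mul_left ?_ (Real.exp_pos (9 * t))
  linarith

/-- Comparison for f' = -6f + g at x = 0, with 325/21 = (1300/21) / (6 - 2). -/
lemma neg_le_fst_zero (h : IsFlow f g m) (hf : f 0 0 = -3965 / 437)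
    (hb : ∀ t ≥ 0, -(1300 / 21) * Real.exp (-2 * t) ≤ g t 0) {t : ℝ} (ht : 0 ≤ t) :
    -(325 / 21) * Real.exp (-2 * t) ≤ f t 0 := by
  have h1 := le_of_hasDerivAt_nonneg
    (φ := fun t => Real.exp (6 * t) * f t 0 + 325 / 21 * Real.exp (4 * t))
    (by have := h.continuous_fst_zero; fun_prop)
    (fun s hs => ((hasDerivAt_exp_mul 6 s).fun_mul (h.hasDerivAt_fst_zero hs)).fun_add
      ((hasDerivAt_exp_mul 4 s).const_mul _))
    (fun s hs0 => by
      have e1 : Real.exp (4 * s) = Real.exp (6 * s) * Real.exp (-2 * s) := by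
        rw [← Real.exp_add]; congr 1; ring
      have := mul_nonneg (Real.exp_pos (6 * s)).le (sub_nonneg.2 (hb s hs0.le))
      rw [e1]
      linarith) ht
  simp only [mul_zero, Real.exp_zero, hf] at h1
  have e1 : Real.exp (4 * t) = Real.exp (6 * t) * Real.exp (-2 * t) := by
    rw [← Real.exp_add]; congr 1; ring
  rw [e1] at h1
  refine le_of_mul_le_mul_left ?_ (Real.exp_pos (6 * t))
  linarith

/-- The weights 1/5 and 1/40 make the derivative of e^s (f/5 + g/40) at x = 0 equal to e^s (-f +
(13/4)σ). Adding e^s m leaves (9/4) e^s σ, which is integrable; 15/2 is (9/4)(10/3). -/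
lemma integral_exp_mul_mean_le (h : IsFlow f g m) (hf : f 0 0 = -3965 / 437)
    (hg : g 0 0 = -10335 / 437)
    (hs : ∀ t ≥ 0, |f t 0 - m t| ≤ 10 / 3 * Real.exp (-2 * t) + 1.66 * Real.exp (-23 * t))
    {t : ℝ} (ht : 0 ≤ t) :
    (∫ s in (0 : ℝ)..t, Real.exp s * m s) + Real.exp t * (1 / 5 * f t 0 + 1 / 40 * g t 0)
      ≤ 5.27 - 15 / 2 * Real.exp (-t) := by
  have hJ : ∀ s, HasDerivAt (fun s => ∫ r in (0 : ℝ)..s, Real.exp r * m r)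
      (Real.exp s * m s) s := fun s => by
    have hc : Continuous fun r => Real.exp r * m r := Real.continuous_exp.mul h.cont_mean
    exact intervalIntegral.integral_hasDerivAt_right (hc.intervalIntegrable _ _)
      (hc.stronglyMeasurableAtFilter _ _) hc.continuousAt
  have h1 := antitoneOn_Ici_of_hasDerivAt
    (φ := fun t => ((∫ s in (0 : ℝ)..t, Real.exp s * m s)
      + Real.exp t * (1 / 5 * f t 0 + 1 / 40 * g t 0)) + 15 / 2 * Real.exp (-1 * t)
      + 9 / 4 * 1.66 / 22 * Real.exp (-22 * t))
    (by
      have := h.continuous_fst_zero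
      have := h.continuous_snd_zero
      have h3 : Continuous fun s => ∫ r in (0 : ℝ)..s, Real.exp r * m r :=
        continuous_iff_continuousAt.2 fun s => (hJ s).continuousAt
      fun_prop)
    (fun s hs => (((hJ s).fun_add ((Real.hasDerivAt_exp s).fun_mul
      (((h.hasDerivAt_fst_zero hs).const_mul _).fun_add
      ((h.hasDerivAt_snd_zero hs).const_mul _)))).fun_add
      ((hasDerivAt_exp_mul (-1) s).const_mul _)).fun_add
      ((hasDerivAt_exp_mul (-22) s).const_mul _))
    (fun s hs0 => by
      have e1 : Real.exp (-1 * s) = Real.exp s * Real.exp (-2 * s) := by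
        rw [← Real.exp_add]; congr 1; ring
      have e2 : Real.exp (-22 * s) = Real.exp s * Real.exp (-23 * s) := by
        rw [← Real.exp_add]; congr 1; ring
      have := mul_nonneg (Real.exp_pos s).le (sub_nonneg.2 (le_of_abs_le (hs s hs0.le)))
      rw [e1, e2]
      linarith) (mem_Ici.2 le_rfl) (mem_Ici.2 ht) ht
  simp only [mul_zero, Real.exp_zero, hf, hg, intervalIntegral.integral_same] at h1
  have := Real.exp_pos (-22 * t)
  have e : -1 * t = -t := by ring
  rw [e] at h1
  linarith

end IsFlow

/-- With y = e^{-t}, the preceding bounds give e^t Υ ≥ 237/23 - 5.27 + (15/2)y - (6/5)(325/21)y -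
(1/40)(1300/21)y - (10/3)y - 1.66 y⁴, which is positive for y ≤ 1/4. -/
lemma IsProfile.upsilonOf_pos {Γ : ℝ → ℝ × ℝ} (h : IsProfile Γ) {U : ℝ → ℝ → ℝ × ℝ}
    (hU : IsEvolution Ltheta (Fstar Γ) U) {t : ℝ} (ht : Real.log 4 ≤ t) :
    0 < UpsilonOf U t := by
  obtain ⟨f, g, m, hF, hf, hg, hm, hs⟩ := h.exists_isFlow hU
  have ht0 : 0 ≤ t := (Real.log_nonneg (by norm_num)).trans ht
  have hb := fun t (ht : t ≥ 0) => hF.neg_le_snd_zero hg hs ht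
  have h1 := hb t ht0
  have h2 := hF.neg_le_fst_zero hf hb ht0
  have h3 := hF.integral_exp_mul_mean_le hf hg hs ht0
  have h4 := le_of_abs_le (hs t ht0)
  have hi : Continuous fun s => Real.exp s * m s := Real.continuous_exp.mul hF.cont_mean
  have e : ∫ s in (0 : ℝ)..t, Real.exp (-(t - s)) * avg (fun θ => (U s θ).1)
      = Real.exp (-t) * (237 / 23 * (Real.exp t - 1) + ∫ s in (0 : ℝ)..t, Real.exp s * m s) := by
    have e1 : ∀ s ∈ uIcc 0 t, Real.exp (-(t - s)) * avg (fun θ => (U s θ).1)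
        = Real.exp (-t) * (237 / 23 * Real.exp s + Real.exp s * m s) := fun s hs => by
      rw [uIcc_of_le ht0] at hs
      rw [hm s hs.1, neg_sub, sub_eq_neg_add, Real.exp_add]
      ring
    rw [intervalIntegral.integral_congr e1, intervalIntegral.integral_const_mul,
      intervalIntegral.integral_add ((Real.continuous_exp.const_mul _).intervalIntegrable _ _)
      (hi.intervalIntegrable _ _), intervalIntegral.integral_const_mul, integral_exp,
      Real.exp_zero]
  rw [UpsilonOf, e, hm t ht0]
  have hpos := Real.exp_pos t
  have e1 : Real.exp t * Real.exp (-t) = 1 := by rw [← Real.exp_add]; simp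
  have e2 : Real.exp (-2 * t) = Real.exp (-t) ^ 2 := by
    rw [← Real.exp_nat_mul]; congr 1; push_cast; ring
  -- The fast term only needs a crude bound: a fifth power of e^{-t} is already negligible.
  have e3 : Real.exp (-23 * t) ≤ Real.exp (-t) ^ 5 := by
    rw [← Real.exp_nat_mul]
    refine Real.exp_le_exp.2 ?_
    push_cast
    linarith
  have hy : Real.exp (-t) ≤ 1 / 4 := by
    rw [Real.exp_neg, one_div]
    refine inv_anti₀ (by norm_num) ?_
    rw [← Real.exp_log (by norm_num : (0 : ℝ) < 4)]
    exact Real.exp_le_exp.2 ht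
  rw [e2] at h1 h2 h4
  have hy0 := Real.exp_pos (-t)
  set y := Real.exp (-t) with hyd
  set E := Real.exp t with hEd
  set J := ∫ s in (0 : ℝ)..t, Real.exp s * m s with hJd
  have h5 : y ^ 4 ≤ (1 / 4) ^ 4 := by gcongr
  have k1 := mul_le_mul_of_nonneg_left h1 hpos.le
  have k2 := mul_le_mul_of_nonneg_left h2 hpos.le
  have k4 := mul_le_mul_of_nonneg_left h4 hpos.le
  have k5 := mul_le_mul_of_nonneg_left e3 hpos.le
  have q2 : E * y ^ 2 = y := by linear_combination y * e1
  have q5 : E * y ^ 5 = y ^ 4 := by linear_combination y ^ 4 * e1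
  rw [q5] at k5
  have r1 : E * (-(1300 / 21) * y ^ 2) = -(1300 / 21) * y := by linear_combination -(1300 / 21) * q2
  have r2 : E * (-(325 / 21) * y ^ 2) = -(325 / 21) * y := by linear_combination -(325 / 21) * q2
  rw [r1] at k1
  rw [r2] at k2
  have r4 : E * (10 / 3 * y ^ 2 + 1.66 * Real.exp (-23 * t))
      = 10 / 3 * y + 1.66 * (E * Real.exp (-23 * t)) := by linear_combination 10 / 3 * q2
  rw [r4] at k4
  refine pos_of_mul_pos_right (a := E) ?_ hpos.le
  have r5 : E * (237 / 23 + m t - y * (237 / 23 * (E - 1) + J))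
      = 237 / 23 + E * m t - J := by
    linear_combination (-(237 / 23 * (E - 1) + J)) * e1
  rw [r5]
  linarith

/-! ### Reduction of the evolution by 𝓛 to the evolution by L_θ. -/

lemma avg_add_const_mul {u v : ℝ → ℝ} (hu : ContinuousOn u (Icc 0 (Real.pi / 2)))
    (hv : ContinuousOn v (Icc 0 (Real.pi / 2))) (c : ℝ) :
    avg (fun θ => u θ + c * v θ) = avg u + c * avg v := by
  have hpi : (0 : ℝ) ≤ Real.pi / 2 := by positivity
  rw [← uIcc_of_le hpi] at hu hv
  rw [avg, avg, avg, intervalIntegral.integral_add hu.intervalIntegrable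
    (hv.intervalIntegrable.const_mul c), intervalIntegral.integral_const_mul]
  ring

lemma D_add_const_mul {u v : ℝ → ℝ} {θ : ℝ} (hu : DifferentiableAt ℝ u θ)
    (hv : DifferentiableAt ℝ v θ) (c : ℝ) :
    D (fun s => u s + c * v s) θ = D u θ + c * D v θ := by
  rw [D, D, D, (hu.hasDerivAt.fun_add (hv.hasDerivAt.const_mul c)).deriv]
  ring

lemma Ltheta_add_smul {V W : ℝ → ℝ × ℝ} (hV : ContinuousOn V (Icc 0 (Real.pi / 2)))
    (hW : ContinuousOn W (Icc 0 (Real.pi / 2))) {θ : ℝ} (dV : DifferentiableAt ℝ V θ)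
    (dW : DifferentiableAt ℝ W θ) (c : ℝ) :
    Ltheta (fun s => V s + c • W s) θ = Ltheta V θ + c • Ltheta W θ := by
  have h1 := D_add_const_mul dV.fst dW.fst c
  have h2 := D_add_const_mul dV.snd dW.snd c
  have h3 := avg_add_const_mul hV.fst hW.fst c
  ext
  · simp only [Ltheta, Prod.fst_add, Prod.snd_add, Prod.smul_fst, Prod.smul_snd, smul_eq_mul, h1]
    ring
  · simp only [Ltheta, Prod.fst_add, Prod.snd_add, Prod.smul_fst, Prod.smul_snd, smul_eq_mul, h2,
      h3]
    ring

namespace IsEvolution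

variable {Γ V₀ : ℝ → ℝ × ℝ} {q : ℝ → ℝ → ℝ × ℝ}

lemma continuousOn_slice {A : (ℝ → ℝ × ℝ) → ℝ → ℝ × ℝ} (h : IsEvolution A V₀ q) {t : ℝ}
    (ht : 0 ≤ t) : ContinuousOn (q t) (Icc 0 (Real.pi / 2)) :=
  h.continuousOn.comp (f := fun θ => (t, θ)) (by fun_prop) (fun _ hθ => ⟨mem_Ici.2 ht, hθ⟩)

/-- The accumulated average `∫_0^t avg q₁`. -/
def cumAvg (q : ℝ → ℝ → ℝ × ℝ) (t : ℝ) : ℝ :=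
  ∫ s in (0 : ℝ)..t, avg (fun θ => (q (max s 0) θ).1)

lemma hasDerivAt_cumAvg {A : (ℝ → ℝ × ℝ) → ℝ → ℝ × ℝ} (h : IsEvolution A V₀ q) (t : ℝ) :
    HasDerivAt (cumAvg q) (avg (fun θ => (q (max t 0) θ).1)) t :=
  intervalIntegral.integral_hasDerivAt_right (h.continuous_avg.intervalIntegrable _ _)
    (h.continuous_avg.stronglyMeasurableAtFilter _ _) h.continuous_avg.continuousAt

/-- Duhamel's principle: `L_θ Γ = 0`, so adding a suitable multiple of `Γ` to an evolution by
`𝓛` gives an evolution by `L_θ`. -/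
lemma add_cumAvg_smul (hΓ : IsProfile Γ) (h : IsEvolution (Lfull Γ) V₀ q) :
    IsEvolution Ltheta V₀ (fun t θ => q t θ + (cumAvg q t / 2) • Γ θ) := by
  have hc : Continuous (cumAvg q) :=
    continuous_iff_continuousAt.2 fun s => (h.hasDerivAt_cumAvg s).continuousAt
  refine ⟨?_, fun t ht θ hθ => ?_, fun t ht θ hθ => ?_, fun θ hθ => ?_⟩
  · refine h.continuousOn.add (ContinuousOn.fun_smul ?_ ?_)
    · exact ((hc.comp continuous_fst).div_const 2).continuousOn
    · exact hΓ.continuousOn.comp continuousOn_snd (fun p hp => hp.2)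
  · refine (h.differentiableAt t ht θ hθ).fun_add (DifferentiableAt.fun_smul ?_ ?_)
    · have : DifferentiableAt ℝ (fun s => cumAvg q s / 2) t :=
        ((h.hasDerivAt_cumAvg t).div_const 2).differentiableAt
      exact DifferentiableAt.comp (t, θ) (f := Prod.fst) this differentiableAt_fst
    · exact (hΓ.differentiableAt θ hθ).comp (t, θ) differentiableAt_snd
  · have hd := h.differentiableAt t ht θ hθ
    have h1 : DifferentiableAt ℝ (fun s => q s θ) t :=
      hd.comp (f := fun s => (s, θ)) t (differentiableAt_id.prodMk (differentiableAt_const θ))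
    have h2 : DifferentiableAt ℝ (q t) θ :=
      hd.comp (f := fun s => (t, s)) θ ((differentiableAt_const t).prodMk differentiableAt_id)
    rw [Ltheta_add_smul (h.continuousOn_slice ht.le) hΓ.continuousOn h2
      (hΓ.differentiableAt θ hθ), hΓ.eqn θ hθ, smul_zero, add_zero,
      (h1.hasDerivAt.fun_add (((h.hasDerivAt_cumAvg t).div_const 2).smul_const (Γ θ))).deriv,
      ← h.eqn t ht θ hθ, Lfull, max_eq_left ht.le]
    abel
  · simp [cumAvg, h.initial θ hθ]

/-- With M = `cumAvg q`, the first component of the modified evolution has mean M' + M because Γ₁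
has mean 2. The convolution integrand is then the exact derivative of e^{-(t-s)} M(s), so
subtracting the integral leaves M'. -/
lemma upsilonOf_add_cumAvg_smul (hΓ : IsProfile Γ) (h : IsEvolution (Lfull Γ) V₀ q) {t : ℝ}
    (ht : 0 ≤ t) :
    UpsilonOf (fun t θ => q t θ + (cumAvg q t / 2) • Γ θ) t = avg (fun θ => (q t θ).1) := by
  have e : ∀ s, 0 ≤ s → avg (fun θ => (q s θ + (cumAvg q s / 2) • Γ θ).1)
      = avg (fun θ => (q (max s 0) θ).1) + cumAvg q s := fun s hs => by
    have := avg_add_const_mul (h.continuousOn_slice hs).fst hΓ.continuousOn.fst (cumAvg q s / 2)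
    rw [hΓ.avg_eq] at this
    simp only [Prod.fst_add, Prod.smul_fst, smul_eq_mul, this, max_eq_left hs]
    ring
  have hd : ∀ s, HasDerivAt (fun s => Real.exp (-(t - s)) * cumAvg q s)
      (Real.exp (-(t - s)) * (avg (fun θ => (q (max s 0) θ).1) + cumAvg q s)) s := fun s => by
    have h1 : HasDerivAt (fun s => -(t - s)) 1 s := by
      simpa using ((hasDerivAt_id s).const_sub t).fun_neg
    exact (h1.exp.fun_mul (h.hasDerivAt_cumAvg s)).congr_deriv (by ring)
  have hc : Continuous (cumAvg q) :=
    continuous_iff_continuousAt.2 fun s => (h.hasDerivAt_cumAvg s).continuousAt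
  have h0 : cumAvg q 0 = 0 := by simp [cumAvg]
  have hi : ∫ s in (0 : ℝ)..t,
      Real.exp (-(t - s)) * avg (fun θ => (q s θ + (cumAvg q s / 2) • Γ θ).1) = cumAvg q t := by
    rw [intervalIntegral.integral_congr (g := fun s =>
      Real.exp (-(t - s)) * (avg (fun θ => (q (max s 0) θ).1) + cumAvg q s)) (fun s hs => by
        rw [uIcc_of_le ht] at hs
        simp only [e s hs.1]),
      intervalIntegral.integral_eq_sub_of_hasDerivAt (fun s _ => hd s)
        (Continuous.intervalIntegrable (by have := h.continuous_avg; fun_prop) _ _), h0]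
    simp
  rw [UpsilonOf, hi, e t ht, max_eq_left ht]
  ring

end IsEvolution

end Angular

end

/-- Both descriptions of `Υ` are positive from time `log 4` on: the angular average of (the first
component of) `exp(-t 𝓛) F^*`, and its expression through `Θ(t) = exp(-t L_θ) F^*`. -/
theorem lemma4p4 (Γ : ℝ → ℝ × ℝ) (hΓ : Angular.IsProfile Γ) :
    (∀ q : ℝ → ℝ → ℝ × ℝ,
      Angular.IsEvolution (Angular.Lfull Γ) (Angular.Fstar Γ) q →
        ∀ t : ℝ, Real.log 4 ≤ t → 0 < Angular.avg (fun θ => (q t θ).1)) ∧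
    (∀ Θ : ℝ → ℝ → ℝ × ℝ,
      Angular.IsEvolution Angular.Ltheta (Angular.Fstar Γ) Θ →
        ∀ t : ℝ, Real.log 4 ≤ t → 0 < Angular.UpsilonOf Θ t) := by
  refine ⟨fun q hq t ht => ?_, fun Θ hΘ t ht => hΓ.upsilonOf_pos hΘ ht⟩
  have h := hΓ.upsilonOf_pos (hq.add_cumAvg_smul hΓ) ht
  rwa [hq.upsilonOf_add_cumAvg_smul hΓ ((Real.log_nonneg (by norm_num)).trans ht)] at h
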